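/- For $n\ge 5$ let $LS_n$ be the set of Latin squares of order $n$, i.e. $n\times n$ matrices in which every row and every column is a permutation of $\{1,\dots,n\}$. Consider the following rejection step of an algorithm that samples from $LS_n$. Let $R_1=(1,\dots,n)$; sample $R_2,\dots,R_{n-3}$ independently and uniformly from the fixed-point-free permutations of $\{1,\dots,n\}$, and, independently, $U$ uniformly from $(0,1)$; let $d$ be the number of Latin squares of order $n$ whose first $n-3$ rows are $R_1,\dots,R_{n-3}$; accept if $U< d/\lfloor 6^{n/3}2^{n/2}\rfloor$, and otherwise discard the sample and repeat the step with fresh independent randomness. Let $E_n$ be the expected number of times that the rows $R_2,\dots,R_{n-3}$ are sampled until the first acceptance (the accepted sample included). Then $$E_n=\frac{\lfloor 6^{n/3}2^{n/2}\rfloor\,[n!/e]^{\,n-4}}{|LS_n|/n!}\qquad (n\ge 5),$$ where $[x]$ denotes the integer closest to $x$, and $$E_n^{1/n^2}\to e\qquad\text{as } n\to\infty .$$ -/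

import Mathlib

open MeasureTheory Filter Topology
open scoped ENNReal

namespace LatinSampling

/-- An `n × n` array with entries in an `n`-element alphabet is a Latin square of order `n` if each
of its rows and each of its columns is a permutation of the alphabet.  Rows, columns and symbols
are all indexed by `Fin n = {0, …, n - 1}`, in place of `{1, …, n}`. -/
def IsLatinSquare {n : ℕ} (L : Matrix (Fin n) (Fin n) (Fin n)) : Prop :=
  (∀ i, Function.Bijective fun j => L i j) ∧ (∀ j, Function.Bijective fun i => L i j)

/-- The set `LS_n` of all Latin squares of order `n`. -/
def latinSquares (n : ℕ) : Set (Matrix (Fin n) (Fin n) (Fin n)) :=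
  {L | IsLatinSquare L}

/-- The fixed-point-free permutations of the alphabet, written as rows. -/
def fixedPointFreeRows (n : ℕ) : Set (Fin n → Fin n) :=
  {f | Function.Bijective f ∧ ∀ j, f j ≠ j}

/-- The tuples `(R_2, …, R_{n-3})` of `n - 4` fixed-point-free permutations. The entry with index
`i : Fin (n - 4)` is the row `R_{i + 2}`. -/
def rowTuples (n : ℕ) : Set (Fin (n - 4) → Fin n → Fin n) :=
  {R | ∀ i, R i ∈ fixedPointFreeRows n}

/-- The number `d` of completions of `(R_1, R_2, …, R_{n-3})`, with `R_1` the identity row: the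
number of Latin squares whose first `n - 3` rows are these. (It is `0` when the given rows already
violate the column conditions.)  With rows indexed from `0`, the row `R_{i + 2}` is row `i + 1`. -/
noncomputable def numCompletions (n : ℕ) (R : Fin (n - 4) → Fin n → Fin n) : ℕ :=
  Set.ncard {L : Matrix (Fin n) (Fin n) (Fin n) | L ∈ latinSquares n ∧
    (∀ r : Fin n, (r : ℕ) = 0 → ∀ j, L r j = j) ∧
    (∀ (i : Fin (n - 4)) (r : Fin n), (r : ℕ) = (i : ℕ) + 1 → ∀ j, L r j = R i j)}

/-- The constant `⌊6^{n/3} 2^{n/2}⌋` in the acceptance test. -/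
noncomputable def acceptBound (n : ℕ) : ℕ :=
  ⌊(6 : ℝ) ^ ((n : ℝ) / 3) * (2 : ℝ) ^ ((n : ℝ) / 2)⌋₊

/-- The randomness used in one pass through the loop of the algorithm: the rows
`R_2, …, R_{n-3}` and the number `u`. -/
abbrev Pass (n : ℕ) : Type := (Fin (n - 4) → Fin n → Fin n) × ℝ

/-- The acceptance test `u < d / ⌊6^{n/3} 2^{n/2}⌋` at the end of a pass. -/
def Accepts (n : ℕ) (x : Pass n) : Prop :=
  x.2 < (numCompletions n x.1 : ℝ) / (acceptBound n : ℝ)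

theorem rowTuples_nonempty (n : ℕ) : (rowTuples n).Nonempty := by
  rcases Nat.lt_or_ge n 5 with h | h
  · refine ⟨fun _ j => j, fun i => ?_⟩
    have := i.2
    omega
  · obtain ⟨m, rfl⟩ : ∃ m, n = m + 2 := ⟨n - 2, by omega⟩
    refine ⟨fun _ j => j + 1, fun _ => ⟨(Equiv.addRight (1 : Fin (m + 2))).bijective, ?_⟩⟩
    intro j hj
    simp at hj

/-- The law of one pass: `(R_2, …, R_{n-3})` is uniform on the tuples of fixed-point-free
permutations (equivalently, the rows are independent and uniform), and `u` is
independent of it and uniform on the interval `(0, 1)`. -/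
noncomputable def passLaw (n : ℕ) : Measure (Pass n) :=
  (ProbabilityTheory.uniformOn (rowTuples n)).prod (volume.restrict (Set.Ioo (0 : ℝ) 1))

instance passLaw_isProbabilityMeasure (n : ℕ) : IsProbabilityMeasure (passLaw n) := by
  have h1 : IsProbabilityMeasure (ProbabilityTheory.uniformOn (rowTuples n)) :=
    ProbabilityTheory.isProbabilityMeasure_uniformOn (Set.toFinite _) (rowTuples_nonempty n)
  have h2 : IsProbabilityMeasure (volume.restrict (Set.Ioo (0 : ℝ) 1)) := ⟨by simp⟩
  unfold passLaw
  infer_instance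

/-- The law of an infinite sequence of independent passes. The algorithm uses the passes
one after the other until it accepts. -/
noncomputable def runLaw (n : ℕ) : Measure (ℕ → Pass n) :=
  Measure.infinitePi fun _ => passLaw n

/-- The number of times the rows `R_2, …, R_{n-3}` are sampled: `t + 1` for the first index `t`
(counted from `0`) whose pass is accepted, and `∞` if there is none. -/
noncomputable def numSamplings (n : ℕ) (ω : ℕ → Pass n) : ℝ≥0∞ :=
  ⨅ (t : ℕ) (_ : Accepts n (ω t)), ((t : ℝ≥0∞) + 1)

/-- The expected number of times the rows `R_2, …, R_{n-3}` are sampled. -/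
noncomputable def expectedSamplings (n : ℕ) : ℝ≥0∞ :=
  ∫⁻ ω, numSamplings n ω ∂(runLaw n)

/-- The quantity `E_n = ⌊6^{n/3} 2^{n/2}⌋ [n!/e]^{n-4} / (|LS_n| / n!)`, where `[x]` is the integer
closest to `x`.  It is used for `n ≥ 5`. -/
noncomputable def E (n : ℕ) : ℝ :=
  (acceptBound n : ℝ) * ((round ((n.factorial : ℝ) / Real.exp 1) : ℤ) : ℝ) ^ (n - 4) /
    (((latinSquares n).ncard : ℝ) / (n.factorial : ℝ))

end LatinSampling

/-! The passes are independent, so the waiting time is geometric and its mean is `1/p`, where `p` is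
the acceptance probability of one pass. Brègman's theorem gives `d ≤ acceptBound n`, so given the
rows a pass is accepted with probability exactly `d / acceptBound n`. Summing `d` over all row
tuples counts each Latin square with identity first row once, that is `|LS_n| / n!` in total, and
there are `D ^ (n - 4)` tuples, where `D = [n!/e]` is the number of derangements. This yields the
formula.

For the limit one needs `log |LS_n| / n² = log n - 2 + o(1)`. A Latin rectangle with `k` missing
rows is extended by a transversal of a `k`-regular set system. The number of these is bounded above
by Brègman (`card_transversals_le`, by Schrijver's entropy-type induction) and below by van der
Waerden (`le_card_transversals`); multiplying over `k` and using Stirling, both bounds have the same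
leading terms. Since `log D / n = log n - 1 + o(1)`, the logarithm of `E n ^ (1 / n²)` tends to `-1
+ 2 = 1`.

Van der Waerden's bound comes from Gurvits' capacity induction, whose inductive step needs only that
mixed permanents are log-concave. This is Alexandrov's inequality, proved by induction with the
Bochner method. -/

namespace LatinSampling

/-! ### Linear algebra: the Bochner method for Lorentzian forms -/

section LorentzianForm

variable {ι : Type*} [Fintype ι]

/-- A symmetric matrix with positive off-diagonal entries satisfying a Bochner-type inequality with
respect to a positive vector `z` is nonpositive on the orthogonal complement of `z`. -/
theorem form_nonpos_of_bochner (A : ι → ι → ℝ) (hsymm : ∀ j k, A j k = A k j)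
    (hpos : ∀ j k, j ≠ k → 0 < A j k) (z b : ι → ℝ) (hz : ∀ j, 0 < z j) (hb : ∀ j, 0 < b j)
    (hAz : ∀ j, ∑ k, A j k * z k = b j)
    (hB : ∀ x : ι → ℝ, ∑ j, x j * ∑ k, A j k * x k ≤ ∑ j, z j / b j * (∑ k, A j k * x k) ^ 2)
    (x : ι → ℝ) (hx : ∑ j, b j * x j = 0) :
    ∑ j, x j * ∑ k, A j k * x k ≤ 0 := by
  classical
  -- For the inner product with weights `p`, the operator `D = p⁻¹ A` is self-adjoint with `D z =
  -- z`, and `hB` says `P ≤ P²` for `P = 1 - D`. As `P ≥ 0` has kernel spanned by `z`, its other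
  -- eigenvalues are at least 1, so `D ≤ 0` on the complement of `z`. The argument below does this
  -- without diagonalizing.
  set p : ι → ℝ := fun j => b j / z j with hp
  have hp0 : ∀ j, 0 < p j := fun j => div_pos (hb j) (hz j)
  have hpz : ∀ j, p j * z j = b j := fun j => div_mul_cancel₀ _ (hz j).ne'
  let M : (ι → ℝ) →ₗ[ℝ] (ι → ℝ) := Matrix.mulVecLin (Matrix.of A)
  have hM : ∀ v j, M v j = ∑ k, A j k * v k := fun v j => by
    simp [M, Matrix.mulVec, dotProduct]
  let D : (ι → ℝ) →ₗ[ℝ] (ι → ℝ) := LinearMap.pi fun j => (p j)⁻¹ • (LinearMap.proj j ∘ₗ M)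
  have hD : ∀ v j, D v j = (p j)⁻¹ * M v j := fun v j => by simp [D]
  let P : (ι → ℝ) →ₗ[ℝ] (ι → ℝ) := LinearMap.id - D
  have hP : ∀ v j, P v j = v j - (p j)⁻¹ * M v j := fun v j => by simp [P, hD]
  have hpP : ∀ v j, p j * P v j = p j * v j - M v j := fun v j => by
    rw [hP, mul_sub, mul_inv_cancel_left₀ (hp0 j).ne']
  have hMsymm : ∀ v w : ι → ℝ, ∑ j, v j * M w j = ∑ j, w j * M v j := fun v w => by
    simp only [hM, Finset.mul_sum]
    rw [Finset.sum_comm]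
    refine Finset.sum_congr rfl fun j _ => Finset.sum_congr rfl fun k _ => ?_
    rw [hsymm]; ring
  -- The form `K v w = N v (P w)`.
  let K : (ι → ℝ) → (ι → ℝ) → ℝ := fun v w => ∑ j, v j * (p j * P w j)
  have hK : ∀ v w, K v w = ∑ j, p j * v j * w j - ∑ j, v j * M w j := fun v w => by
    simp only [K, hpP, ← Finset.sum_sub_distrib]
    exact Finset.sum_congr rfl fun j _ => by ring
  -- Because `A z = p z`, the form `K` is a Dirichlet energy: the diagonal of `A`, whose sign is
  -- unknown, drops out, and only multiples of `z` have energy zero.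
  have hKsq : ∀ v, K v v = 1 / 2 * ∑ j, ∑ k, A j k * z j * z k * (v j / z j - v k / z k) ^ 2 := by
    intro v
    have e1 : ∑ j, p j * v j * v j = ∑ j, ∑ k, A j k * z j * z k * (v j / z j) ^ 2 := by
      refine Finset.sum_congr rfl fun j _ => ?_
      have : ∀ k, A j k * z j * z k * (v j / z j) ^ 2 = A j k * z k * (z j * (v j / z j) ^ 2) :=
        fun k => by ring
      simp only [this, ← Finset.sum_mul, hAz, hp]
      have := (hz j).ne'
      field_simp
    have e2 : ∑ j, p j * v j * v j = ∑ j, ∑ k, A j k * z j * z k * (v k / z k) ^ 2 := by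
      rw [e1, Finset.sum_comm]
      refine Finset.sum_congr rfl fun j _ => Finset.sum_congr rfl fun k _ => ?_
      rw [hsymm]; ring
    have e3 : ∑ j, v j * M v j = ∑ j, ∑ k, A j k * z j * z k * (v j / z j) * (v k / z k) := by
      refine Finset.sum_congr rfl fun j _ => ?_
      rw [hM, Finset.mul_sum]
      refine Finset.sum_congr rfl fun k _ => ?_
      have := (hz j).ne'
      have := (hz k).ne'
      field_simp
    have e4 : K v v = 1 / 2 * (∑ j, p j * v j * v j + ∑ j, p j * v j * v j
        - 2 * ∑ j, v j * M v j) := by rw [hK]; ring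
    rw [e4]
    nth_rewrite 1 [e1]
    rw [e2, e3, Finset.mul_sum, ← Finset.sum_add_distrib, ← Finset.sum_sub_distrib]
    congr 1
    refine Finset.sum_congr rfl fun j _ => ?_
    rw [Finset.mul_sum, ← Finset.sum_add_distrib, ← Finset.sum_sub_distrib]
    exact Finset.sum_congr rfl fun k _ => by ring
  have hterm : ∀ v : ι → ℝ, ∀ j k, 0 ≤ A j k * z j * z k * (v j / z j - v k / z k) ^ 2 := by
    intro v j k
    by_cases h : j = k
    · simp [h]
    · have := hpos j k h
      have := hz j
      have := hz k
      positivity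
  have hK0 : ∀ v, 0 ≤ K v v := fun v => by
    rw [hKsq]
    exact mul_nonneg (by norm_num)
      (Finset.sum_nonneg fun j _ => Finset.sum_nonneg fun k _ => hterm v j k)
  have hKsymm : ∀ v w, K v w = K w v := fun v w => by
    rw [hK, hK, hMsymm]
    congr 1
    exact Finset.sum_congr rfl fun j _ => by ring
  have hKcs : ∀ v w, K v w ^ 2 ≤ K v v * K w w := by
    intro v w
    have hquad : ∀ t : ℝ, 0 ≤ K w w * (t * t) + 2 * K v w * t + K v v := by
      intro t
      have := hK0 (v + t • w)
      have e : K (v + t • w) (v + t • w) = K v v + t * K v w + t * K w v + t * t * K w w := by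
        simp only [K, map_add, map_smul, Pi.add_apply, Pi.smul_apply, smul_eq_mul,
          Finset.mul_sum, ← Finset.sum_add_distrib]
        exact Finset.sum_congr rfl fun j _ => by ring
      rw [e, hKsymm w v] at this
      linarith
    have := discrim_le_zero hquad
    rw [discrim] at this
    nlinarith
  -- `P` preserves the complement of `z` and is injective there.
  let φ : (ι → ℝ) →ₗ[ℝ] ℝ := ∑ j, b j • LinearMap.proj j
  have hφ : ∀ v, φ v = ∑ j, b j * v j := fun v => by simp [φ]
  have hφP : ∀ v, φ (P v) = 0 := fun v => by
    rw [hφ]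
    have e : ∀ j, b j * P v j = b j * v j - z j * M v j := fun j => by
      rw [← hpz j, mul_comm (p j), mul_assoc, hpP]; ring
    simp only [e, Finset.sum_sub_distrib]
    rw [hMsymm z v, sub_eq_zero]
    exact Finset.sum_congr rfl fun j _ => by rw [hM, hAz]; ring
  have hinj : ∀ v, φ v = 0 → P v = 0 → v = 0 := by
    intro v hv hPv
    have h0 : K v v = 0 := by simp [K, hPv]
    rw [hKsq] at h0
    have h1 : ∑ j, ∑ k, A j k * z j * z k * (v j / z j - v k / z k) ^ 2 = 0 := by linarith
    rw [Finset.sum_eq_zero_iff_of_nonneg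
      fun j _ => Finset.sum_nonneg fun k _ => hterm v j k] at h1
    have h2 : ∀ j k, v j / z j = v k / z k := by
      intro j k
      by_cases h : j = k
      · rw [h]
      have h3 := (Finset.sum_eq_zero_iff_of_nonneg fun k _ => hterm v j k).1
        (h1 j (Finset.mem_univ _)) k (Finset.mem_univ _)
      have h4 : 0 < A j k * z j * z k := by
        have := hpos j k h
        have := hz j
        have := hz k
        positivity
      have := (mul_eq_zero.1 h3).resolve_left h4.ne'
      exact sub_eq_zero.1 (pow_eq_zero_iff (two_ne_zero) |>.1 this)
    funext i
    have h5 : φ v = (∑ j, b j * z j) * (v i / z i) := by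
      rw [hφ, Finset.sum_mul]
      refine Finset.sum_congr rfl fun j _ => ?_
      rw [← h2 j i]
      have := (hz j).ne'
      field_simp
    have h6 : 0 < ∑ j, b j * z j :=
      Finset.sum_pos (fun j _ => mul_pos (hb j) (hz j)) ⟨i, Finset.mem_univ i⟩
    rw [hv] at h5
    have := (mul_eq_zero.1 h5.symm).resolve_left h6.ne'
    simpa [(hz i).ne'] using this
  let W := LinearMap.ker φ
  have hPW : ∀ v ∈ W, P v ∈ W := fun v _ => hφP v
  have hsurj : Function.Surjective (P.restrict hPW) := by
    rw [← LinearMap.injective_iff_surjective]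
    rw [← LinearMap.ker_eq_bot, LinearMap.ker_eq_bot']
    rintro ⟨v, hv⟩ h
    have h' : P v = 0 := congrArg Subtype.val h
    exact Subtype.ext (hinj v hv h')
  obtain ⟨⟨y, hy⟩, hyx⟩ := hsurj ⟨x, (hφ x).trans hx⟩
  have hyx : P y = x := congrArg Subtype.val hyx
  -- With `x = P y`, `hB` at `y` becomes `K y y ≤ s`. Cauchy–Schwarz gives `s² = (K y x)² ≤ s * K x
  -- x`, hence `s ≤ K x x = s - ⟨x, A x⟩`.
  set s := ∑ j, p j * x j * x j with hs
  have hs1 : K y x = s := by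
    rw [hKsymm]
    simp only [K, hyx, hs]
    exact Finset.sum_congr rfl fun j _ => by ring
  have hs2 : K y y ≤ s := by
    have hB' := hB y
    have e1 : ∑ j, y j * ∑ k, A j k * y k = ∑ j, p j * y j * y j - K y y := by
      rw [hK]; simp only [hM]; ring
    have e2 : ∑ j, z j / b j * (∑ k, A j k * y k) ^ 2
        = ∑ j, p j * y j * y j - 2 * K y y + s := by
      have e3 : ∀ j, z j / b j * (∑ k, A j k * y k) ^ 2
          = p j * y j * y j - 2 * (y j * (p j * P y j)) + p j * x j * x j := by
        intro j
        have h1 := hpP y j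
        have h2 : ∑ k, A j k * y k = p j * (y j - x j) := by
          rw [← hM, ← hyx]; linarith
        have h3 : z j / b j = (p j)⁻¹ := by simp [hp]
        rw [h2, h3, hyx]
        have := (hp0 j).ne'
        field_simp
        ring
      simp only [e3, Finset.sum_add_distrib, Finset.sum_sub_distrib, ← Finset.mul_sum, K, hs]
    rw [e1, e2] at hB'
    linarith
  have hs3 : s ^ 2 ≤ K y y * K x x := hs1 ▸ hKcs y x
  have hs0 : 0 ≤ s := Finset.sum_nonneg fun j _ => by
    have := (hp0 j).le
    nlinarith [mul_nonneg this (mul_self_nonneg (x j))]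
  have hs4 : s ≤ K x x := by
    rcases hs0.eq_or_lt with h | h
    · rw [← h]; exact hK0 x
    · have : s * s ≤ s * K x x := by
        nlinarith [mul_le_mul_of_nonneg_right hs2 (hK0 x)]
      exact le_of_mul_le_mul_left this h
  have : K x x = s - ∑ j, x j * M x j := hK x x
  simp only [hM] at this
  linarith

/-- Reverse Cauchy–Schwarz for a form that is nonpositive on a hyperplane `⟨·, z⟩ = 0`. -/
theorem reverse_cauchy_schwarz {V : Type*} [AddCommGroup V] [Module ℝ V]
    (B : V →ₗ[ℝ] V →ₗ[ℝ] ℝ) (hsymm : ∀ x y, B x y = B y x) (z : V)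
    (hneg : ∀ x, B x z = 0 → B x x ≤ 0) (x y : V) (hy : 0 < B y y) :
    B x x * B y y ≤ B x y ^ 2 := by
  have hyz : B y z ≠ 0 := fun h => (hneg y h).not_gt hy
  -- This `t` makes `x - t • y` orthogonal to `z`; completing the square in `t * B y y` then gives
  -- the claim.
  set t := B x z / B y z with ht
  have h := hneg (x - t • y) (by simp [ht, hyz])
  simp only [map_sub, map_smul, LinearMap.sub_apply, LinearMap.smul_apply, smul_eq_mul,
    hsymm y x] at h
  nlinarith [sq_nonneg (t * B y y - B x y)]

end LorentzianForm

/-! ### Mixed permanents and Alexandrov's inequality -/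

section ListPermanent

variable {ι : Type*} [DecidableEq ι]

/-- The permanent of the matrix with row set `S` and the given list of columns, expanded
along the columns. -/
noncomputable def listPermanent : Finset ι → List (ι → ℝ) → ℝ
  | _, [] => 1
  | S, c :: cs => ∑ i ∈ S, c i * listPermanent (S.erase i) cs

@[simp] theorem listPermanent_nil (S : Finset ι) : listPermanent S [] = 1 := rfl

theorem listPermanent_cons (S : Finset ι) (c : ι → ℝ) (cs : List (ι → ℝ)) :
    listPermanent S (c :: cs) = ∑ i ∈ S, c i * listPermanent (S.erase i) cs := rfl

theorem listPermanent_cons_cons (S : Finset ι) (c d : ι → ℝ) (cs : List (ι → ℝ)) :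
    listPermanent S (c :: d :: cs) =
      ∑ i ∈ S, ∑ j ∈ S, if i = j then 0 else c i * d j * listPermanent ((S.erase i).erase j) cs := by
  rw [listPermanent_cons]
  refine Finset.sum_congr rfl fun i _ => ?_
  rw [listPermanent_cons, Finset.mul_sum]
  have h : S.erase i = S.filter (fun j => ¬ i = j) := by
    ext j
    simp only [Finset.mem_erase, Finset.mem_filter]
    tauto
  rw [Finset.sum_congr h fun _ _ => rfl, Finset.sum_filter]
  refine Finset.sum_congr rfl fun j _ => ?_
  by_cases hij : i = j <;> simp [hij, mul_assoc]

theorem listPermanent_perm {l l' : List (ι → ℝ)} (h : l.Perm l') (S : Finset ι) :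
    listPermanent S l = listPermanent S l' := by
  induction h generalizing S with
  | nil => rfl
  | cons c _ ih => simp only [listPermanent_cons, ih]
  | swap c d l =>
    rw [listPermanent_cons_cons, listPermanent_cons_cons, Finset.sum_comm]
    refine Finset.sum_congr rfl fun i _ => Finset.sum_congr rfl fun j _ => ?_
    by_cases hij : i = j
    · simp [hij]
    · rw [if_neg hij, if_neg (Ne.symm hij), Finset.erase_right_comm, mul_comm (c i)]
  | trans _ _ ih₁ ih₂ => rw [ih₁, ih₂]

theorem listPermanent_pos (l : List (ι → ℝ)) (hl : ∀ c ∈ l, ∀ i, 0 < c i) (S : Finset ι)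
    (hS : l.length ≤ S.card) : 0 < listPermanent S l := by
  induction l generalizing S with
  | nil => simp
  | cons c cs ih =>
    rw [List.length_cons] at hS
    refine Finset.sum_pos (fun i hi => mul_pos (hl c (by simp) i) ?_)
      (Finset.card_pos.1 (by omega))
    refine ih (fun d hd => hl d (by simp [hd])) _ ?_
    rw [Finset.card_erase_of_mem hi]
    omega

theorem listPermanent_add_smul (S : Finset ι) (c d : ι → ℝ) (t : ℝ) (cs : List (ι → ℝ)) :
    listPermanent S ((c + t • d) :: cs) =
      listPermanent S (c :: cs) + t * listPermanent S (d :: cs) := by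
  simp only [listPermanent_cons, Finset.mul_sum, ← Finset.sum_add_distrib]
  exact Finset.sum_congr rfl fun i _ => by simp; ring

theorem listPermanent_add (S : Finset ι) (c d : ι → ℝ) (cs : List (ι → ℝ)) :
    listPermanent S ((c + d) :: cs) =
      listPermanent S (c :: cs) + listPermanent S (d :: cs) := by
  simpa using listPermanent_add_smul S c d 1 cs

theorem listPermanent_smul (S : Finset ι) (t : ℝ) (c : ι → ℝ) (cs : List (ι → ℝ)) :
    listPermanent S ((t • c) :: cs) = t * listPermanent S (c :: cs) := by
  simp only [listPermanent_cons, Finset.mul_sum]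
  exact Finset.sum_congr rfl fun i _ => by simp; ring

theorem listPermanent_replicate (S : Finset ι) (u : ι → ℝ) :
    listPermanent S (List.replicate S.card u) = S.card.factorial * ∏ i ∈ S, u i := by
  obtain ⟨m, hm⟩ : ∃ m, S.card = m := ⟨_, rfl⟩
  rw [hm]
  induction m generalizing S with
  | zero =>
    rw [Finset.card_eq_zero] at hm
    simp [hm]
  | succ m ih =>
    rw [List.replicate_succ, listPermanent_cons]
    have : ∀ i ∈ S, u i * listPermanent (S.erase i) (List.replicate m u)
        = m.factorial * ∏ i ∈ S, u i := by
      intro i hi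
      rw [ih _ (by rw [Finset.card_erase_of_mem hi, hm]; rfl), ← Finset.mul_prod_erase S u hi]
      ring
    rw [Finset.sum_congr rfl this, Finset.sum_const, hm, Nat.factorial_succ]
    push_cast
    rw [nsmul_eq_mul]
    push_cast
    ring

/-- Two columns of the permanent as a bilinear form. -/
noncomputable def permanentForm (S : Finset ι) (cs : List (ι → ℝ)) :
    (ι → ℝ) →ₗ[ℝ] (ι → ℝ) →ₗ[ℝ] ℝ :=
  LinearMap.mk₂ ℝ (fun x y => listPermanent S (x :: y :: cs))
    (fun _ _ _ => listPermanent_add _ _ _ _)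
    (fun _ _ _ => listPermanent_smul _ _ _ _)
    (fun x y z => by
      simp only [listPermanent_perm (List.Perm.swap _ x _), listPermanent_add])
    (fun t x y => by
      simp only [listPermanent_perm (List.Perm.swap _ x _), listPermanent_smul, smul_eq_mul])

theorem permanentForm_apply (S : Finset ι) (cs : List (ι → ℝ)) (x y : ι → ℝ) :
    permanentForm S cs x y = listPermanent S (x :: y :: cs) := rfl

/-- Alexandrov's inequality for permanents. -/
theorem listPermanent_alexandrov (cs : List (ι → ℝ)) (hcs : ∀ c ∈ cs, ∀ i, 0 < c i)
    (S : Finset ι) (hS : S.card = cs.length + 2) (x y : ι → ℝ) (hy : ∀ i, 0 < y i) :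
    listPermanent S (x :: x :: cs) * listPermanent S (y :: y :: cs) ≤
      listPermanent S (x :: y :: cs) ^ 2 := by
  induction cs generalizing S x y with
  | nil =>
    obtain ⟨a, b, hab, rfl⟩ := Finset.card_eq_two.1 hS
    have h1 : ∀ u v : ι → ℝ, listPermanent {a, b} [u, v] = u a * v b + u b * v a := by
      intro u v
      simp only [listPermanent_cons, listPermanent_nil, mul_one]
      rw [Finset.sum_pair hab, Finset.erase_insert (by simpa using hab)]
      rw [show ({a, b} : Finset ι).erase b = {a} by
        rw [Finset.pair_comm, Finset.erase_insert (by simpa using hab.symm)]]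
      simp
    simp only [h1]
    nlinarith [sq_nonneg (x a * y b - x b * y a)]
  | cons w ws ih =>
    have hw : ∀ i, 0 < w i := hcs w (by simp)
    have hws : ∀ c ∈ ws, ∀ i, 0 < c i := fun c hc => hcs c (by simp [hc])
    rw [List.length_cons] at hS
    have hcard : ∀ i ∈ S, (S.erase i).card = ws.length + 2 := fun i hi => by
      rw [Finset.card_erase_of_mem hi, hS]; rfl
    -- The first remaining column `w` serves as reference vector: it suffices that the form is
    -- nonpositive on the complement of `w`.
    refine reverse_cauchy_schwarz (permanentForm S (w :: ws))
      (fun u v => listPermanent_perm (List.Perm.swap _ _ _) _) w ?_ x y ?_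
    swap
    · refine listPermanent_pos _ ?_ _ (by simp [hS])
      intro c hc
      simp only [List.mem_cons] at hc
      rcases hc with rfl | rfl | rfl | hc
      exacts [hy, hy, hw, hws c hc]
    intro v hv
    simp only [permanentForm_apply] at hv ⊢
    -- `A j k` is the permanent with the rows `j`, `k` and the first two columns deleted.
    let A : S → S → ℝ := fun j k =>
      if j = k then 0 else listPermanent ((S.erase j).erase k) (w :: ws)
    have hA : ∀ (u : ι → ℝ) (j : S), ∑ k, A j k * u k = listPermanent (S.erase j) (u :: w :: ws) := by
      intro u j
      rw [listPermanent_cons, ← Finset.sum_subset (Finset.subset_univ (Finset.univ.erase j))]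
      · refine Finset.sum_bij (fun k _ => (k : ι)) ?_ ?_ ?_ ?_
        · intro k hk
          simp only [Finset.mem_erase, Finset.mem_univ, and_true] at hk
          exact Finset.mem_erase.2 ⟨fun h => hk (Subtype.ext h), k.2⟩
        · intro k _ l _ h
          exact Subtype.ext h
        · intro k hk
          rw [Finset.mem_erase] at hk
          exact ⟨⟨k, hk.2⟩, by simpa [Subtype.ext_iff] using hk.1, rfl⟩
        · intro k hk
          simp only [Finset.mem_erase, Finset.mem_univ, and_true] at hk
          simp only [A, if_neg (Ne.symm hk)]
          ring
      · intro k _ hk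
        have : k = j := by simpa using hk
        simp [A, this]
    have hform : ∀ u : ι → ℝ,
        ∑ j : S, u j * ∑ k, A j k * u k = listPermanent S (u :: u :: w :: ws) := by
      intro u
      simp only [hA]
      rw [listPermanent_cons, ← Finset.sum_coe_sort S]
    have hb : ∀ j : S, 0 < listPermanent (S.erase j) (w :: w :: ws) := by
      intro j
      refine listPermanent_pos _ ?_ _ (by rw [hcard j j.2]; simp)
      intro c hc
      simp only [List.mem_cons] at hc
      rcases hc with rfl | rfl | hc
      exacts [hw, hw, hws c hc]
    rw [← hform]
    refine form_nonpos_of_bochner A ?_ ?_ (fun j => w j)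
      (fun j => listPermanent (S.erase j) (w :: w :: ws)) (fun j => hw j) hb (fun j => hA w j) ?_
      (fun j => v j) ?_
    · intro j k
      by_cases h : j = k
      · rw [h]
      · simp only [A, if_neg h, if_neg (Ne.symm h), Finset.erase_right_comm]
    · intro j k h
      simp only [A, if_neg h]
      refine listPermanent_pos _ hcs _ ?_
      rw [Finset.card_erase_of_mem, hcard j j.2]
      · simp
      · exact Finset.mem_erase.2 ⟨fun h' => h (Subtype.ext h'.symm), k.2⟩
    -- The Bochner inequality is the induction hypothesis: expanding along `w` writes the form as a
    -- sum of `w j` times minors with columns `u, u, ws`, and Alexandrov for `u, w` in each minor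
    -- bounds these by `(A u)_j ² / b_j`. Values of `u` outside `S` do not matter and are set to 0.
    · intro u'
      let u : ι → ℝ := fun i => if h : i ∈ S then u' ⟨i, h⟩ else 0
      have hu : u' = fun j : S => u j := by
        funext j
        simp [u]
      rw [hu, hform, listPermanent_perm (l' := w :: u :: u :: ws)]
      · rw [listPermanent_cons, ← Finset.sum_coe_sort S]
        refine Finset.sum_le_sum fun j _ => ?_
        simp only [hA]
        rw [div_mul_eq_mul_div, mul_div_assoc]
        refine mul_le_mul_of_nonneg_left ?_ (hw j).le
        rw [le_div_iff₀ (hb j)]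
        exact ih hws _ (hcard j j.2) u w hw
      · exact ((List.Perm.swap w u ws).cons u).trans (List.Perm.swap w u _)
    · rw [← hv, listPermanent_cons, ← Finset.sum_coe_sort S]
      exact Finset.sum_congr rfl fun j _ => mul_comm _ _

end ListPermanent

/-! ### Gurvits' capacity inequality -/

section Capacity

variable {ι : Type*} [DecidableEq ι]

/-- The form of Alexandrov's inequality comparing powers of columns. -/
theorem listPermanent_pow_le (u v : ι → ℝ) (hu : ∀ i, 0 < u i) (hv : ∀ i, 0 < v i)
    (ds : List (ι → ℝ)) (hds : ∀ c ∈ ds, ∀ i, 0 < c i) (S : Finset ι) (m : ℕ)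
    (hS : S.card = m + 1 + ds.length) :
    listPermanent S (List.replicate (m + 1) v ++ ds) ≤
      listPermanent S (List.replicate (m + 1) u ++ ds) *
        (listPermanent S (v :: (List.replicate m u ++ ds)) /
          listPermanent S (List.replicate (m + 1) u ++ ds)) ^ (m + 1) := by
  -- Replacing copies of `u` by `v` one at a time gives a log-concave sequence, so its successive
  -- ratios never exceed `g 1 / g 0`.
  set g : ℕ → ℝ := fun k =>
    listPermanent S (List.replicate (m + 1 - k) u ++ (List.replicate k v ++ ds)) with hg
  have hpos : ∀ k ≤ m + 1, 0 < g k := by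
    intro k hk
    refine listPermanent_pos _ ?_ _ ?_
    · intro c hc
      simp only [List.mem_append, List.mem_replicate] at hc
      rcases hc with ⟨_, rfl⟩ | ⟨_, rfl⟩ | hc
      exacts [hu, hv, hds c hc]
    · simp only [List.length_append, List.length_replicate]
      omega
  have hlc : ∀ k, k + 2 ≤ m + 1 → g k * g (k + 2) ≤ g (k + 1) ^ 2 := by
    intro k hk
    obtain ⟨a, ha⟩ : ∃ a, m + 1 = a + k + 2 := ⟨m + 1 - (k + 2), by omega⟩
    have h := listPermanent_alexandrov (List.replicate a u ++ (List.replicate k v ++ ds)) (by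
      intro c hc
      simp only [List.mem_append, List.mem_replicate] at hc
      rcases hc with ⟨_, rfl⟩ | ⟨_, rfl⟩ | hc
      exacts [hu, hv, hds c hc]) S (by
        simp only [List.length_append, List.length_replicate]
        omega) u v hv
    have e0 : g k = listPermanent S
        (u :: u :: (List.replicate a u ++ (List.replicate k v ++ ds))) := by
      simp only [hg, show m + 1 - k = a + 2 by omega]
      rfl
    have e1 : g (k + 1) = listPermanent S
        (u :: v :: (List.replicate a u ++ (List.replicate k v ++ ds))) := by
      simp only [hg, show m + 1 - (k + 1) = a + 1 by omega]
      exact listPermanent_perm (List.perm_middle.cons u) _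
    have e2 : g (k + 2) = listPermanent S
        (v :: v :: (List.replicate a u ++ (List.replicate k v ++ ds))) := by
      simp only [hg, show m + 1 - (k + 2) = a by omega]
      exact listPermanent_perm (List.perm_middle.trans (List.perm_middle.cons v)) _
    rw [e0, e1, e2]
    exact h
  have e0 : listPermanent S (List.replicate (m + 1) u ++ ds) = g 0 := by simp [hg]
  have e1 : listPermanent S (v :: (List.replicate m u ++ ds)) = g 1 := by
    simp only [hg]
    exact listPermanent_perm List.perm_middle.symm _
  have e2 : listPermanent S (List.replicate (m + 1) v ++ ds) = g (m + 1) := by simp [hg]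
  rw [e0, e1, e2]
  have hg0 := hpos 0 (by omega)
  have hratio : ∀ k, k + 1 ≤ m + 1 → g (k + 1) ≤ g k * (g 1 / g 0) := by
    intro k
    induction k with
    | zero => intro _; rw [mul_div_cancel₀ _ hg0.ne']
    | succ k ih =>
      intro hk
      have h1 := hlc k hk
      have h2 := ih (by omega)
      have h3 := hpos k (by omega)
      have h4 := hpos (k + 1) (by omega)
      refine le_of_mul_le_mul_left ?_ h3
      calc g k * g (k + 1 + 1) ≤ g (k + 1) * g (k + 1) := by rw [← sq]; exact h1
        _ ≤ g (k + 1) * (g k * (g 1 / g 0)) := mul_le_mul_of_nonneg_left h2 h4.le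
        _ = g k * (g (k + 1) * (g 1 / g 0)) := by ring
  have hr : 0 ≤ g 1 / g 0 := div_nonneg (hpos 1 (by omega)).le hg0.le
  have hall : ∀ k, k ≤ m + 1 → g k ≤ g 0 * (g 1 / g 0) ^ k := by
    intro k
    induction k with
    | zero => intro _; simp
    | succ k ih =>
      intro hk
      calc g (k + 1) ≤ g k * (g 1 / g 0) := hratio k hk
        _ ≤ g 0 * (g 1 / g 0) ^ k * (g 1 / g 0) :=
          mul_le_mul_of_nonneg_right (ih (by omega)) hr
        _ = _ := by ring
  exact hall (m + 1) le_rfl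

/-- Gurvits' capacity inequality, for products of linear forms with positive coefficients. -/
theorem capacity_le_listPermanent (S : Finset ι) (cs : List (ι → ℝ)) :
    ∀ ds : List (ι → ℝ), (∀ c ∈ cs, ∀ i, 0 < c i) → (∀ c ∈ ds, ∀ i, 0 < c i) →
      S.card = cs.length + ds.length → ∀ C : ℝ,
      (∀ xs : List ℝ, xs.length = cs.length → (∀ x ∈ xs, 0 < x) →
        C * xs.prod ≤ listPermanent S
          (List.replicate cs.length (List.zipWith (fun (x : ℝ) (c : ι → ℝ) => x • c) xs cs).sum
            ++ ds)) →
      C / (cs.length : ℝ) ^ cs.length ≤ listPermanent S (cs ++ ds) := by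
  induction cs with
  | nil =>
    intro ds _ _ _ C h
    simpa using h [] rfl (by simp)
  | cons c cs ih =>
    intro ds hcs hds hS C h
    have hc : ∀ i, 0 < c i := hcs c (by simp)
    have hcs' : ∀ d ∈ cs, ∀ i, 0 < d i := fun d hd => hcs d (by simp [hd])
    have hds' : ∀ d ∈ c :: ds, ∀ i, 0 < d i := by
      intro d hd
      rcases List.mem_cons.1 hd with rfl | hd
      exacts [hc, hds d hd]
    rw [List.length_cons] at hS
    -- Moving `c` from the variable columns to the fixed ones costs a factor `m ^ m / (m + 1) ^ (m +
    -- 1)` in the capacity; these factors telescope.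
    have key := ih (c :: ds) hcs' hds' (by rw [hS, List.length_cons]; omega)
    have hperm : listPermanent S (cs ++ c :: ds) = listPermanent S (c :: cs ++ ds) :=
      listPermanent_perm List.perm_middle _
    rw [hperm] at key
    obtain ⟨m, hm⟩ : ∃ m, cs.length = m := ⟨_, rfl⟩
    simp only [List.length_cons, hm] at h key hS ⊢
    rcases Nat.eq_zero_or_pos m with rfl | hmpos
    · rw [List.length_eq_zero_iff] at hm
      subst hm
      simpa using h [1] rfl (by simp)
    have hm0 : (0 : ℝ) < m := by exact_mod_cast hmpos
    refine le_trans (le_of_eq ?_)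
      (key (C * (m : ℝ) ^ m / ((m + 1 : ℕ) : ℝ) ^ (m + 1)) fun xs hxs hx => ?_)
    · field_simp
    set u : ι → ℝ := (List.zipWith (fun (x : ℝ) (c : ι → ℝ) => x • c) xs cs).sum with hu
    have hupos : ∀ i, 0 < u i := by
      have aux : ∀ (ys : List ℝ) (es : List (ι → ℝ)), ys.length = es.length → es ≠ [] →
          (∀ y ∈ ys, 0 < y) → (∀ d ∈ es, ∀ i, 0 < d i) →
          ∀ i, 0 < (List.zipWith (fun (x : ℝ) (c : ι → ℝ) => x • c) ys es).sum i := by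
        intro ys es
        induction es generalizing ys with
        | nil => intro _ h; exact absurd rfl h
        | cons d es ih =>
          intro hl _ hy hd i
          cases ys with
          | nil => simp at hl
          | cons y ys =>
            have h1 : 0 < y * d i := mul_pos (hy y (by simp)) (hd d (by simp) i)
            simp only [List.zipWith_cons_cons, List.sum_cons, Pi.add_apply, Pi.smul_apply,
              smul_eq_mul]
            by_cases hes : es = []
            · subst hes
              simpa using h1
            · have := ih ys (by simpa using hl) hes (fun y hy' => hy y (by simp [hy']))
                (fun d hd' => hd d (by simp [hd'])) i
              linarith
      exact aux xs cs (by rw [hxs, hm]) (fun h => by simp [h] at hm; omega) hx hcs'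
    obtain ⟨m', rfl⟩ : ∃ m', m = m' + 1 := ⟨m - 1, by omega⟩
    set m := m' + 1 with hmdef
    set c₀ := listPermanent S (List.replicate (m + 1) u ++ ds) with hc₀
    set c₁ := listPermanent S (List.replicate m u ++ c :: ds) with hc₁
    have hc₀pos : 0 < c₀ := by
      refine listPermanent_pos _ ?_ _ (by simp [hS])
      intro d hd
      simp only [List.mem_append, List.mem_replicate] at hd
      rcases hd with ⟨_, rfl⟩ | hd
      exacts [hupos, hds d hd]
    have hc₁pos : 0 < c₁ := by
      refine listPermanent_pos _ ?_ _ (by simp [hS]; omega)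
      intro d hd
      simp only [List.mem_append, List.mem_replicate] at hd
      rcases hd with ⟨_, rfl⟩ | hd
      exacts [hupos, hds' d hd]
    -- The minimizer over `t > 0` of `c₀ * ((c₀ + t * c₁) / c₀) ^ (m + 1) / t`.
    set t : ℝ := c₀ / (c₁ * m) with ht
    have htpos : 0 < t := by positivity
    have h1 := h (t :: xs) (by simp [hxs]) (by
      intro y hy
      rcases List.mem_cons.1 hy with rfl | hy
      exacts [htpos, hx y hy])
    simp only [List.zipWith_cons_cons, List.sum_cons, List.prod_cons, ← hu] at h1
    have hv : ∀ i, 0 < (t • c + u) i := fun i => by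
      have := hc i
      have := hupos i
      simp only [Pi.add_apply, Pi.smul_apply, smul_eq_mul]
      positivity
    have h2 := listPermanent_pow_le u (t • c + u) hupos hv ds hds S m (by rw [hS])
    have h3 : listPermanent S ((t • c + u) :: (List.replicate m u ++ ds)) = c₀ + t * c₁ := by
      rw [add_comm, listPermanent_add_smul, hc₀, hc₁,
        listPermanent_perm (l' := c :: (List.replicate m u ++ ds)) List.perm_middle]
      rfl
    rw [h3] at h2
    have h4 : (c₀ + t * c₁) / c₀ = (m + 1) / m := by
      rw [ht]
      field_simp
    rw [h4] at h2
    have h5 : C * (t * xs.prod) ≤ c₀ * ((m + 1) / m : ℝ) ^ (m + 1) := h1.trans h2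
    have hm1 : (0 : ℝ) < m + 1 := by positivity
    have h6 : C * xs.prod * (m : ℝ) ^ m * t ≤ c₁ * ((m : ℝ) + 1) ^ (m + 1) * t := by
      calc C * xs.prod * (m : ℝ) ^ m * t = C * (t * xs.prod) * (m : ℝ) ^ m := by ring
        _ ≤ c₀ * ((m + 1) / m : ℝ) ^ (m + 1) * (m : ℝ) ^ m :=
          mul_le_mul_of_nonneg_right h5 (by positivity)
        _ = c₁ * ((m : ℝ) + 1) ^ (m + 1) * t := by
          rw [ht, div_pow, pow_succ (m : ℝ) m]
          field_simp
    have h7 := le_of_mul_le_mul_right h6 htpos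
    rw [div_mul_eq_mul_div, div_le_iff₀ (by positivity)]
    push_cast
    linarith

end Capacity

/-! ### Van der Waerden's bound and transversals of regular set systems -/

section VanDerWaerden

/-- The column sums split each `x j` into powers `x j ^ a i j`; weighted AM–GM in each row finishes.
Thus the capacity of a doubly stochastic matrix is at least 1. -/
theorem prod_le_prod_sum_of_doublyStochastic {ι : Type*} [Fintype ι] (a : ι → ι → ℝ)
    (ha : ∀ i j, 0 ≤ a i j) (hrow : ∀ i, ∑ j, a i j = 1) (hcol : ∀ j, ∑ i, a i j = 1)
    (x : ι → ℝ) (hx : ∀ j, 0 < x j) :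
    ∏ j, x j ≤ ∏ i, ∑ j, x j * a i j := by
  calc ∏ j, x j = ∏ j, x j ^ ∑ i, a i j := by simp [hcol]
    _ = ∏ j, ∏ i, x j ^ a i j :=
      Finset.prod_congr rfl fun j _ => Real.rpow_sum_of_pos (hx j) _ _
    _ = ∏ i, ∏ j, x j ^ a i j := Finset.prod_comm
    _ ≤ ∏ i, ∑ j, x j * a i j := by
      refine Finset.prod_le_prod (fun i _ => Finset.prod_nonneg fun j _ =>
        Real.rpow_nonneg (hx j).le _) fun i _ => ?_
      simp only [mul_comm (x _)]
      exact Real.geom_mean_le_arith_mean_weighted _ _ _ (fun j _ => ha i j) (hrow i)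
        fun j _ => (hx j).le

theorem listPermanent_ofFn {ι : Type*} [DecidableEq ι] [Fintype ι] {m : ℕ}
    (col : Fin m → ι → ℝ) (S : Finset ι) :
    listPermanent S (List.ofFn col) =
      ∑ f : Fin m → ι, if Function.Injective f ∧ ∀ j, f j ∈ S then ∏ j, col j (f j) else 0 := by
  induction m generalizing S with
  | zero =>
    simp [Function.injective_of_subsingleton]
  | succ m ih =>
    rw [List.ofFn_succ, listPermanent_cons, ← (Fin.consEquiv fun _ => ι).sum_comp,
      Fintype.sum_prod_type, ← Finset.sum_subset (Finset.subset_univ S)]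
    · refine Finset.sum_congr rfl fun i hi => ?_
      rw [ih, Finset.mul_sum]
      refine Finset.sum_congr rfl fun f _ => ?_
      have hiff : (Function.Injective f ∧ ∀ j, f j ∈ S.erase i) ↔
          (Function.Injective (Fin.cons i f : Fin (m + 1) → ι) ∧
            ∀ j, (Fin.cons i f : Fin (m + 1) → ι) j ∈ S) := by
        rw [Fin.cons_injective_iff, Fin.forall_fin_succ]
        simp only [Fin.cons_zero, Fin.cons_succ, Finset.mem_erase, Set.mem_range, not_exists]
        exact ⟨fun h => ⟨⟨fun j => (h.2 j).1, h.1⟩, hi, fun j => (h.2 j).2⟩,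
          fun h => ⟨h.1.2, fun j => ⟨h.1.1 j, h.2.2 j⟩⟩⟩
      rw [show Fin.consEquiv (fun _ => ι) (i, f) = Fin.cons i f from rfl]
      by_cases h : Function.Injective f ∧ ∀ j, f j ∈ S.erase i
      · rw [if_pos h, if_pos (hiff.1 h), Fin.prod_univ_succ]
        simp
      · rw [if_neg h, if_neg (fun h' => h (hiff.2 h')), mul_zero]
    · intro i _ hi
      refine Finset.sum_eq_zero fun f _ => if_neg fun h => hi ?_
      simpa using h.2 0

open scoped Classical in
/-- The van der Waerden bound for positive doubly stochastic matrices. -/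
theorem vanDerWaerden_of_pos {n : ℕ} (a : Fin n → Fin n → ℝ)
    (ha : ∀ i j, 0 < a i j) (hrow : ∀ i, ∑ j, a i j = 1) (hcol : ∀ j, ∑ i, a i j = 1) :
    (n.factorial : ℝ) / (n : ℝ) ^ n ≤
      ∑ f : Fin n → Fin n, if Function.Bijective f then ∏ j, a (f j) j else 0 := by
  -- `C = n!` is admissible because `n` equal columns `u` have permanent `n! ∏ u i`.
  have h := capacity_le_listPermanent (Finset.univ : Finset (Fin n))
    (List.ofFn fun j i => a i j) [] (by
      intro c hc i
      obtain ⟨j, rfl⟩ := (List.mem_ofFn' _ _).1 hc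
      exact ha i j) (by simp) (by simp) n.factorial (by
    intro xs hxs hpos
    rw [List.length_ofFn] at hxs ⊢
    obtain ⟨x, rfl⟩ : ∃ x : Fin n → ℝ, xs = List.ofFn x :=
      ⟨fun j => xs.get (j.cast hxs.symm), by subst hxs; exact (List.ofFn_get xs).symm⟩
    have hx : ∀ j, 0 < x j := fun j => hpos _ ((List.mem_ofFn' _ _).2 ⟨j, rfl⟩)
    have hz : List.zipWith (fun (t : ℝ) (c : Fin n → ℝ) => t • c) (List.ofFn x)
        (List.ofFn fun j i => a i j) = List.ofFn fun j i => x j * a i j := by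
      refine List.ext_getElem (by simp) fun k h1 h2 => ?_
      simp only [List.getElem_zipWith, List.getElem_ofFn]
      rfl
    rw [hz, List.append_nil, List.sum_ofFn, List.prod_ofFn]
    have h := listPermanent_replicate (Finset.univ : Finset (Fin n))
      (∑ j, fun i => x j * a i j)
    rw [Finset.card_univ, Fintype.card_fin] at h
    rw [h]
    refine mul_le_mul_of_nonneg_left ?_ (by positivity)
    simp only [Finset.sum_apply]
    exact prod_le_prod_sum_of_doublyStochastic a (fun i j => (ha i j).le) hrow hcol x hx)
  rw [List.append_nil, listPermanent_ofFn, List.length_ofFn] at h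
  refine h.trans (le_of_eq (Finset.sum_congr rfl fun f _ => ?_))
  simp [Finite.injective_iff_bijective]

open scoped Classical in
/-- The van der Waerden bound for doubly stochastic matrices. -/
theorem vanDerWaerden {n : ℕ} (a : Fin n → Fin n → ℝ)
    (ha : ∀ i j, 0 ≤ a i j) (hrow : ∀ i, ∑ j, a i j = 1) (hcol : ∀ j, ∑ i, a i j = 1) :
    (n.factorial : ℝ) / (n : ℝ) ^ n ≤
      ∑ f : Fin n → Fin n, if Function.Bijective f then ∏ j, a (f j) j else 0 := by
  rcases Nat.eq_zero_or_pos n with rfl | hn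
  · simp
  have hn' : (0 : ℝ) < n := by exact_mod_cast hn
  -- Mixing with the constant matrix `1/n` makes all entries positive and keeps the matrix doubly
  -- stochastic; then `ε → 0`.
  let F : ℝ → ℝ := fun ε => ∑ f : Fin n → Fin n,
    if Function.Bijective f then ∏ j, ((1 - ε) * a (f j) j + ε / n) else 0
  have hF : Continuous F := by
    refine continuous_finsetSum _ fun f _ => ?_
    by_cases h : Function.Bijective f
    · simp only [if_pos h]
      fun_prop
    · simp only [if_neg h]
      fun_prop
  have hF0 : Tendsto F (𝓝[>] 0) (𝓝 (F 0)) := hF.continuousAt.tendsto.mono_left nhdsWithin_le_nhds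
  have hlim : (n.factorial : ℝ) / (n : ℝ) ^ n ≤ F 0 := by
    refine ge_of_tendsto hF0 ?_
    filter_upwards [Ioo_mem_nhdsGT (show (0 : ℝ) < 1 by norm_num)] with ε hε
    refine vanDerWaerden_of_pos (fun i j => (1 - ε) * a i j + ε / n) ?_ ?_ ?_
    · intro i j
      have := mul_nonneg (sub_nonneg.2 hε.2.le) (ha i j)
      have := div_pos hε.1 hn'
      linarith
    · intro i
      rw [Finset.sum_add_distrib, ← Finset.mul_sum, hrow]
      simp
      field_simp
      ring
    · intro j
      rw [Finset.sum_add_distrib, ← Finset.mul_sum, hcol]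
      simp
      field_simp
      ring
  simpa [F] using hlim

open scoped Classical in
/-- The bijective choice functions of a set system. -/
noncomputable def transversals {α : Type*} [Fintype α] (A : α → Finset α) : Finset (α → α) :=
  Finset.univ.filter fun f => Function.Bijective f ∧ ∀ i, f i ∈ A i

theorem mem_transversals {α : Type*} [Fintype α] {A : α → Finset α} {f : α → α} :
    f ∈ transversals A ↔ Function.Bijective f ∧ ∀ i, f i ∈ A i := by
  simp [transversals]

-- The incidence matrix divided by `k` is doubly stochastic, and its permanent is the number of
-- transversals divided by `k ^ n`.
open scoped Classical in
theorem le_card_transversals {n k : ℕ} (hk : 0 < k) (A : Fin n → Finset (Fin n))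
    (hrow : ∀ j, (A j).card = k) (hcol : ∀ i, (Finset.univ.filter fun j => i ∈ A j).card = k) :
    (k : ℝ) ^ n * (n.factorial / (n : ℝ) ^ n) ≤ (transversals A).card := by
  have hk' : (0 : ℝ) < k := by exact_mod_cast hk
  have h := vanDerWaerden (fun i j => if i ∈ A j then (k : ℝ)⁻¹ else 0)
    (fun i j => by positivity)
    (fun i => by
      rw [← Finset.sum_filter, Finset.sum_const, hcol, nsmul_eq_mul]
      exact mul_inv_cancel₀ hk'.ne')
    (fun j => by
      rw [← Finset.sum_filter, Finset.sum_const, Finset.filter_mem_eq_inter, Finset.univ_inter,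
        hrow, nsmul_eq_mul]
      exact mul_inv_cancel₀ hk'.ne')
  have e : ∀ f : Fin n → Fin n, (if Function.Bijective f then
      ∏ j, (if f j ∈ A j then (k : ℝ)⁻¹ else 0) else 0) =
      if Function.Bijective f ∧ ∀ i, f i ∈ A i then ((k : ℝ) ^ n)⁻¹ else 0 := by
    intro f
    rw [ite_and]
    congr 1
    by_cases h : ∀ i, f i ∈ A i
    · simp [h]
    · rw [if_neg h]
      push Not at h
      obtain ⟨i, hi⟩ := h
      exact Finset.prod_eq_zero (Finset.mem_univ i) (if_neg hi)
  simp only [e] at h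
  rw [← Finset.sum_filter, Finset.sum_const, nsmul_eq_mul] at h
  rw [mul_comm, ← le_mul_inv_iff₀ (by positivity)]
  rw [show transversals A = Finset.univ.filter fun f => Function.Bijective f ∧ ∀ i, f i ∈ A i by
    ext f
    simp [mem_transversals]]
  exact h

end VanDerWaerden

/-! ### Brègman's theorem, after Schrijver -/

section Bregman

/-- `log (r!) / r`, the contribution of a row with `r` ones to Brègman's bound. -/
noncomputable def logFactorialDiv (r : ℕ) : ℝ := Real.log r.factorial / r

theorem logFactorialDiv_one : logFactorialDiv 1 = 0 := by simp [logFactorialDiv]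

theorem mul_logFactorialDiv (r : ℕ) : r * logFactorialDiv r = Real.log r.factorial := by
  rcases Nat.eq_zero_or_pos r with rfl | h
  · simp
  · have : (0 : ℝ) < r := by exact_mod_cast h
    rw [logFactorialDiv, mul_div_cancel₀ _ this.ne']

/-- The log-sum inequality with equal weights. -/
theorem mul_log_le_sum {κ : Type*} (s : Finset κ) (p : κ → ℝ) (hp : ∀ k ∈ s, 0 ≤ p k)
    (hs : 0 < ∑ k ∈ s, p k) :
    (∑ k ∈ s, p k) * Real.log (∑ k ∈ s, p k) ≤
      (∑ k ∈ s, p k) * Real.log s.card + ∑ k ∈ s, p k * Real.log (p k) := by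
  set P := ∑ k ∈ s, p k with hP
  have hne : s.Nonempty := Finset.nonempty_of_sum_ne_zero hs.ne'
  have hr : (0 : ℝ) < s.card := by exact_mod_cast hne.card_pos
  have h : ∀ k ∈ s, p k * (Real.log P - Real.log s.card - Real.log (p k)) ≤ P / s.card - p k := by
    intro k hk
    rcases (hp k hk).eq_or_lt with h0 | h0
    · rw [← h0]
      simpa using (div_pos hs hr).le
    · rw [← Real.log_div hs.ne' hr.ne', ← Real.log_div (div_pos hs hr).ne' h0.ne']
      have := Real.log_le_sub_one_of_pos (div_pos (div_pos hs hr) h0)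
      calc _ ≤ p k * (P / s.card / p k - 1) := mul_le_mul_of_nonneg_left this h0.le
        _ = _ := by field_simp
  have h2 := Finset.sum_le_sum h
  simp only [Finset.sum_sub_distrib, mul_sub, ← Finset.sum_mul, ← hP, Finset.sum_const,
    nsmul_eq_mul] at h2
  rw [mul_div_cancel₀ _ hr.ne'] at h2
  linarith

variable {α : Type*} [Fintype α] [DecidableEq α]

/-- The set system whose transversals are those of `A` that choose `k` from `A i`. -/
def fixChoice (A : α → Finset α) (i k : α) (j : α) : Finset α :=
  if j = i then {k} else (A j).erase k

theorem transversals_fixChoice (A : α → Finset α) {i k : α} (hk : k ∈ A i) :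
    transversals (fixChoice A i k) = (transversals A).filter fun f => f i = k := by
  ext f
  rw [Finset.mem_filter, mem_transversals, mem_transversals]
  constructor
  · rintro ⟨hf, h⟩
    have hi : f i = k := by simpa [fixChoice] using h i
    refine ⟨⟨hf, fun j => ?_⟩, hi⟩
    by_cases hj : j = i
    · rw [hj, hi]; exact hk
    · have := h j
      rw [fixChoice, if_neg hj] at this
      exact Finset.mem_of_mem_erase this
  · rintro ⟨⟨hf, h⟩, hi⟩
    refine ⟨hf, fun j => ?_⟩
    by_cases hj : j = i
    · rw [hj, hi]; simp [fixChoice]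
    · rw [fixChoice, if_neg hj]
      exact Finset.mem_erase.2 ⟨fun h' => hj (hf.1 (h'.trans hi.symm)), h j⟩

/-- Brègman's bound in logarithmic form, by induction on the set `T` of rows that may have more
than one choice. -/
theorem log_card_transversals_le_aux (m : ℕ) : ∀ (T : Finset α), T.card = m →
    ∀ A : α → Finset α, (∀ i ∉ T, ∃ k, A i = {k} ∧ ∀ j ≠ i, k ∉ A j) →
      (transversals A).Nonempty →
      Real.log (transversals A).card ≤ ∑ i, logFactorialDiv (A i).card := by
  induction m with
  | zero =>
    intro T hT A hA _
    rw [Finset.card_eq_zero] at hT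
    subst hT
    have h1 : ∀ i, (A i).card = 1 := fun i => by
      obtain ⟨k, hk, _⟩ := hA i (by simp)
      rw [hk, Finset.card_singleton]
    simp only [h1, logFactorialDiv_one, Finset.sum_const_zero]
    refine Real.log_nonpos (by positivity) ?_
    have : (transversals A).card ≤ 1 := by
      refine Finset.card_le_one.2 fun f hf g hg => funext fun i => ?_
      exact Finset.card_le_one.1 (h1 i).le _ ((mem_transversals.1 hf).2 i) _
        ((mem_transversals.1 hg).2 i)
    exact_mod_cast this
  | succ m ih =>
    intro T hT A hA hne
    set S := transversals A with hS
    have hPpos : (0 : ℝ) < S.card := by exact_mod_cast hne.card_pos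
    set r : α → ℕ := fun i => (A i).card with hr
    -- Split the transversals by their value at `i`: log-sum over the fibres, then the induction
    -- hypothesis for each nonempty fibre.
    have hrow : ∀ i ∈ T, (S.card : ℝ) * Real.log S.card ≤ S.card * Real.log (r i) +
        ∑ f ∈ S, ∑ j, logFactorialDiv (fixChoice A i (f i) j).card := by
      intro i hi
      have hmaps : ∀ f ∈ S, f i ∈ A i := fun f hf => (mem_transversals.1 hf).2 i
      have hsum : (S.card : ℝ) = ∑ k ∈ A i, ((S.filter fun f => f i = k).card : ℝ) := by
        exact_mod_cast Finset.card_eq_sum_card_fiberwise hmaps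
      have h1 := mul_log_le_sum (A i) (fun k => ((S.filter fun f => f i = k).card : ℝ))
        (fun _ _ => by positivity) (hsum ▸ hPpos)
      rw [← hsum] at h1
      refine h1.trans (add_le_add_right ?_ _)
      rw [← Finset.sum_fiberwise_of_maps_to hmaps]
      refine Finset.sum_le_sum fun k hk => ?_
      have h2 : ∑ f ∈ S.filter (fun f => f i = k),
          ∑ j, logFactorialDiv (fixChoice A i (f i) j).card =
          (S.filter fun f => f i = k).card *
            ∑ j, logFactorialDiv (fixChoice A i k j).card := by
        rw [Finset.sum_congr rfl (g := fun _ => ∑ j, logFactorialDiv (fixChoice A i k j).card),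
          Finset.sum_const, nsmul_eq_mul]
        intro f hf
        rw [(Finset.mem_filter.1 hf).2]
      rw [h2]
      rcases (S.filter fun f => f i = k).eq_empty_or_nonempty with h0 | h0
      · simp [h0]
      refine mul_le_mul_of_nonneg_left ?_ (by positivity)
      rw [← transversals_fixChoice A hk] at h0 ⊢
      refine ih (T.erase i) (by rw [Finset.card_erase_of_mem hi, hT]; rfl) _ ?_ h0
      intro i' hi'
      by_cases hii : i' = i
      · subst hii
        refine ⟨k, by simp [fixChoice], fun j hj => ?_⟩
        rw [fixChoice, if_neg hj]
        exact Finset.notMem_erase _ _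
      · obtain ⟨k', hk', hk''⟩ := hA i' fun h => hi' (Finset.mem_erase.2 ⟨hii, h⟩)
        have hkk : k' ≠ k := fun h => hk'' i (Ne.symm hii) (h ▸ hk)
        refine ⟨k', ?_, fun j hj => ?_⟩
        · rw [fixChoice, if_neg hii, hk', Finset.erase_eq_of_notMem]
          simpa using hkk.symm
        · by_cases hji : j = i
          · simpa [fixChoice, hji] using hkk
          · rw [fixChoice, if_neg hji]
            exact fun h => hk'' j hj (Finset.mem_of_mem_erase h)
    -- Fix `f` and `j ∈ T`. Of the `m + 1` choices of `i`, one (`i = j`) leaves a singleton,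
    -- contributing 0; `r j - 1` remove an element from `A j`; the rest leave it unchanged. With
    -- `log (r j)` added, the first two kinds sum to `log (r j)!`, which is `r j * logFactorialDiv
    -- (r j)`.
    have hcol : ∀ f ∈ S, ∑ i ∈ T, Real.log (r i) +
        ∑ i ∈ T, ∑ j, logFactorialDiv (fixChoice A i (f i) j).card =
        (m + 1) * ∑ j, logFactorialDiv (r j) := by
      intro f hf
      obtain ⟨hbij, hmem⟩ := mem_transversals.1 hf
      rw [Finset.sum_comm, ← Finset.sum_filter_add_sum_filter_not Finset.univ (· ∈ T),
        ← Finset.sum_filter_add_sum_filter_not Finset.univ (· ∈ T) fun j => logFactorialDiv (r j),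
        Finset.filter_mem_eq_inter, Finset.univ_inter, ← add_assoc, ← Finset.sum_add_distrib,
        mul_add]
      congr 1
      · rw [Finset.mul_sum]
        refine Finset.sum_congr rfl fun j hj => ?_
        have hrj : 0 < r j := Finset.card_pos.2 ⟨_, hmem j⟩
        have hcount : (T.filter fun i => f i ∈ A j).card = r j := by
          rw [← Finset.card_image_of_injective _ hbij.1]
          congr 1
          ext k
          simp only [Finset.mem_image, Finset.mem_filter]
          constructor
          · rintro ⟨i, ⟨_, h⟩, rfl⟩
            exact h
          · intro hk
            obtain ⟨i, rfl⟩ := hbij.2 k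
            refine ⟨i, ⟨?_, hk⟩, rfl⟩
            by_contra hi
            obtain ⟨k', hk', hk''⟩ := hA i hi
            have h3 := hmem i
            rw [hk', Finset.mem_singleton] at h3
            exact hk'' j (fun h => hi (h ▸ hj)) (h3 ▸ hk)
        have hterm : ∀ i ∈ T, logFactorialDiv (fixChoice A i (f i) j).card =
            logFactorialDiv (r j) +
              (if f i ∈ A j then logFactorialDiv (r j - 1) - logFactorialDiv (r j) else 0) -
              (if i = j then logFactorialDiv (r j - 1) else 0) := by
          intro i _
          by_cases hij : i = j
          · subst hij
            simp [fixChoice, hmem i, logFactorialDiv_one]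
          · rw [fixChoice, if_neg (Ne.symm hij), if_neg hij]
            by_cases h : f i ∈ A j
            · rw [if_pos h, Finset.card_erase_of_mem h]
              ring
            · rw [if_neg h, Finset.erase_eq_of_notMem h]
              ring
        rw [Finset.sum_congr rfl hterm, Finset.sum_sub_distrib, Finset.sum_add_distrib,
          ← Finset.sum_filter, Finset.sum_const, Finset.sum_const, hcount, hT,
          Finset.sum_ite_eq' T j, if_pos hj]
        simp only [nsmul_eq_mul]
        have h4 := mul_logFactorialDiv (r j)
        have h5 := mul_logFactorialDiv (r j - 1)
        have h6 : Real.log ((r j).factorial) = Real.log (r j) + Real.log (r j - 1).factorial := by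
          rw [← Real.log_mul (by positivity) (by positivity), ← Nat.cast_mul,
            Nat.mul_factorial_pred hrj.ne']
        rw [Nat.cast_sub (by omega)] at h5
        push_cast at h5 ⊢
        linarith
      · rw [Finset.mul_sum]
        refine Finset.sum_congr rfl fun j hj => ?_
        obtain ⟨k', hk', hk''⟩ := hA j (Finset.mem_filter.1 hj).2
        have h1 : r j = 1 := by simp [hr, hk']
        rw [h1, logFactorialDiv_one, mul_zero]
        refine Finset.sum_eq_zero fun i hi => ?_
        have hij : j ≠ i := fun h => (Finset.mem_filter.1 hj).2 (h ▸ hi)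
        rw [fixChoice, if_neg hij, Finset.erase_eq_of_notMem fun h => ?_]
        · rw [show (A j).card = 1 from h1, logFactorialDiv_one]
        · rw [hk', Finset.mem_singleton] at h
          exact hk'' i (Ne.symm hij) (h ▸ hmem i)
    -- Sum over `i ∈ T`, exchange with the sum over `f`, insert `hcol`, and divide by `(m + 1) *
    -- S.card`.
    have htot := Finset.sum_le_sum hrow
    rw [Finset.sum_add_distrib, Finset.sum_const, hT, ← Finset.mul_sum, Finset.sum_comm,
      nsmul_eq_mul] at htot
    have hall := Finset.sum_congr rfl hcol
    rw [Finset.sum_add_distrib, Finset.sum_const, Finset.sum_const, nsmul_eq_mul,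
      nsmul_eq_mul] at hall
    rw [hall] at htot
    have hm : (0 : ℝ) < (m + 1) * S.card := by positivity
    refine le_of_mul_le_mul_left ?_ hm
    push_cast at htot
    linarith

/-- Brègman's theorem. -/
theorem card_transversals_le (A : α → Finset α) :
    ((transversals A).card : ℝ) ≤ Real.exp (∑ i, logFactorialDiv (A i).card) := by
  rcases (transversals A).eq_empty_or_nonempty with h | h
  · rw [h]
    simpa using (Real.exp_pos _).le
  · have hpos : (0 : ℝ) < (transversals A).card := by exact_mod_cast h.card_pos
    rw [← Real.log_le_iff_le_exp hpos]
    exact log_card_transversals_le_aux _ Finset.univ rfl A (by simp) h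

end Bregman

/-! ### Counting extensions of Latin rectangles row by row -/

section Extensions

variable {n : ℕ}

open scoped Classical in
/-- The Latin squares whose rows with index in `F` agree with `L₀`. -/
noncomputable def latinExtensions (F : Finset (Fin n)) (L₀ : Fin n → Fin n → Fin n) :
    Finset (Fin n → Fin n → Fin n) :=
  Finset.univ.filter fun L => IsLatinSquare L ∧ ∀ i ∈ F, L i = L₀ i

theorem mem_latinExtensions {F : Finset (Fin n)} {L₀ L : Fin n → Fin n → Fin n} :
    L ∈ latinExtensions F L₀ ↔ IsLatinSquare L ∧ ∀ i ∈ F, L i = L₀ i := by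
  simp [latinExtensions]

/-- The rows of `L₀` with index in `F` form a Latin rectangle. -/
def IsLatinOn (F : Finset (Fin n)) (L₀ : Fin n → Fin n → Fin n) : Prop :=
  (∀ i ∈ F, Function.Bijective (L₀ i)) ∧ ∀ j, Set.InjOn (fun i => L₀ i j) F

/-- The symbols that are not yet used in column `j`. -/
def unusedSymbols (F : Finset (Fin n)) (L₀ : Fin n → Fin n → Fin n) (j : Fin n) :
    Finset (Fin n) :=
  (F.image fun i => L₀ i j)ᶜ

theorem mem_unusedSymbols {F : Finset (Fin n)} {L₀ : Fin n → Fin n → Fin n} {j s : Fin n} :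
    s ∈ unusedSymbols F L₀ j ↔ ∀ i ∈ F, L₀ i j ≠ s := by
  simp [unusedSymbols]

theorem card_unusedSymbols {F : Finset (Fin n)} {L₀ : Fin n → Fin n → Fin n}
    (h : IsLatinOn F L₀) (j : Fin n) : (unusedSymbols F L₀ j).card = n - F.card := by
  rw [unusedSymbols, Finset.card_compl, Fintype.card_fin, Finset.card_image_of_injOn (h.2 j)]

/-- Each row in `F` contains `s` exactly once, and different rows have it in different columns. -/
theorem card_columns_unused {F : Finset (Fin n)} {L₀ : Fin n → Fin n → Fin n}
    (h : IsLatinOn F L₀) (s : Fin n) :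
    (Finset.univ.filter fun j => s ∈ unusedSymbols F L₀ j).card = n - F.card := by
  have hex : ∀ i ∈ F, ∃ j, L₀ i j = s := fun i hi => (h.1 i hi).2 s
  choose g hg using hex
  have hcard : F.card = (Finset.univ.filter fun j => ¬ s ∈ unusedSymbols F L₀ j).card := by
    refine Finset.card_bij g ?_ ?_ ?_
    · intro i hi
      simp only [Finset.mem_filter, Finset.mem_univ, true_and, mem_unusedSymbols]
      exact fun h' => h' i hi (hg i hi)
    · intro i hi i' hi' heq
      refine h.2 (g i hi) hi hi' ?_
      change L₀ i (g i hi) = L₀ i' (g i hi)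
      rw [hg, heq, hg]
    · intro j hj
      simp only [Finset.mem_filter, Finset.mem_univ, true_and, mem_unusedSymbols] at hj
      push Not at hj
      obtain ⟨i, hi, hij⟩ := hj
      exact ⟨i, hi, (h.1 i hi).1 ((hg i hi).trans hij.symm)⟩
  have := Finset.card_filter_add_card_filter_not (s := (Finset.univ : Finset (Fin n)))
    (fun j => s ∈ unusedSymbols F L₀ j)
  rw [Finset.card_univ, Fintype.card_fin, ← hcard] at this
  omega

theorem IsLatinSquare.isLatinOn {L : Fin n → Fin n → Fin n} (h : IsLatinSquare L)
    (F : Finset (Fin n)) : IsLatinOn F L :=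
  ⟨fun i _ => h.1 i, fun j => (h.2 j).1.injOn⟩

theorem IsLatinOn.congr {F : Finset (Fin n)} {L L' : Fin n → Fin n → Fin n} (h : IsLatinOn F L)
    (he : ∀ i ∈ F, L i = L' i) : IsLatinOn F L' := by
  refine ⟨fun i hi => he i hi ▸ h.1 i hi, fun j i hi i' hi' heq => h.2 j hi hi' ?_⟩
  change L i j = L i' j
  rw [he i hi, he i' hi']
  exact heq

theorem isLatinOn_of_nonempty {F : Finset (Fin n)} {L₀ : Fin n → Fin n → Fin n}
    (h : (latinExtensions F L₀).Nonempty) : IsLatinOn F L₀ := by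
  obtain ⟨L, hL⟩ := h
  rw [mem_latinExtensions] at hL
  exact (hL.1.isLatinOn F).congr hL.2

theorem IsLatinOn.update {F : Finset (Fin n)} {L₀ : Fin n → Fin n → Fin n} (h : IsLatinOn F L₀)
    {i : Fin n} (hi : i ∉ F) {σ : Fin n → Fin n} (hσ : σ ∈ transversals (unusedSymbols F L₀)) :
    IsLatinOn (insert i F) (Function.update L₀ i σ) := by
  obtain ⟨hb, hm⟩ := mem_transversals.1 hσ
  have hne : ∀ k ∈ F, Function.update L₀ i σ k = L₀ k := fun k hk =>
    Function.update_of_ne (fun h' : k = i => hi (h' ▸ hk)) _ _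
  have hF : IsLatinOn F (Function.update L₀ i σ) := h.congr fun k hk => (hne k hk).symm
  refine ⟨fun k hk => ?_, fun j => ?_⟩
  · rcases Finset.mem_insert.1 hk with rfl | hk
    · simpa using hb
    · exact hF.1 k hk
  · rw [Finset.coe_insert, Set.injOn_insert (by simpa using hi)]
    refine ⟨hF.2 j, ?_⟩
    rintro ⟨k, hk, heq⟩
    have heq : Function.update L₀ i σ k j = Function.update L₀ i σ i j := heq
    rw [hne k hk, Function.update_self] at heq
    exact mem_unusedSymbols.1 (hm j) k hk heq

theorem card_latinExtensions_eq_sum (F : Finset (Fin n)) (L₀ : Fin n → Fin n → Fin n)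
    {i : Fin n} (hi : i ∉ F) :
    (latinExtensions F L₀).card = ∑ σ ∈ transversals (unusedSymbols F L₀),
      (latinExtensions (insert i F) (Function.update L₀ i σ)).card := by
  have hmaps : ∀ L ∈ latinExtensions F L₀, L i ∈ transversals (unusedSymbols F L₀) := by
    intro L hL
    obtain ⟨hl, he⟩ := mem_latinExtensions.1 hL
    refine mem_transversals.2 ⟨hl.1 i, fun j => mem_unusedSymbols.2 fun k hk heq => ?_⟩
    rw [← he k hk] at heq
    exact hi ((hl.2 j).1 heq ▸ hk)
  rw [Finset.card_eq_sum_card_fiberwise hmaps]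
  refine Finset.sum_congr rfl fun σ _ => congrArg _ ?_
  ext L
  rw [Finset.mem_filter, mem_latinExtensions, mem_latinExtensions, Finset.forall_mem_insert,
    Function.update_self]
  have : (∀ k ∈ F, L k = Function.update L₀ i σ k) ↔ ∀ k ∈ F, L k = L₀ k :=
    forall₂_congr fun k hk => by
      rw [Function.update_of_ne (fun h' : k = i => hi (h' ▸ hk))]
  rw [this]
  tauto

theorem card_latinExtensions_univ {L₀ : Fin n → Fin n → Fin n}
    (h : IsLatinOn Finset.univ L₀) : (latinExtensions Finset.univ L₀).card = 1 := by
  rw [Finset.card_eq_one]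
  refine ⟨L₀, ?_⟩
  ext L
  rw [mem_latinExtensions, Finset.mem_singleton]
  constructor
  · exact fun hL => funext fun i => hL.2 i (Finset.mem_univ i)
  · rintro rfl
    refine ⟨⟨fun i => h.1 i (Finset.mem_univ i), fun j => ?_⟩, fun _ _ => rfl⟩
    refine Finite.injective_iff_bijective.1 ?_
    have := h.2 j
    rwa [Finset.coe_univ, Set.injOn_univ] at this

/-- The number of completions of a Latin rectangle with `k` missing rows. -/
theorem card_latinExtensions_bounds (k : ℕ) :
    ∀ (F : Finset (Fin n)) (L₀ : Fin n → Fin n → Fin n), F.card + k = n → IsLatinOn F L₀ →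
    ∏ j ∈ Finset.range k, (((j + 1 : ℕ) : ℝ) ^ n * (n.factorial / (n : ℝ) ^ n)) ≤
        (latinExtensions F L₀).card ∧
      ((latinExtensions F L₀).card : ℝ) ≤
        ∏ j ∈ Finset.range k, Real.exp (n * logFactorialDiv (j + 1)) := by
  induction k with
  | zero =>
    intro F L₀ hF h
    have : F = Finset.univ := by
      rw [← Finset.card_eq_iff_eq_univ, Fintype.card_fin]
      exact hF
    subst this
    rw [card_latinExtensions_univ h]
    simp
  | succ k ih =>
    intro F L₀ hF h
    obtain ⟨i, hi⟩ : ∃ i, i ∉ F := by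
      by_contra! hall
      have : F = Finset.univ := Finset.eq_univ_iff_forall.2 hall
      rw [this, Finset.card_univ, Fintype.card_fin] at hF
      omega
    have hk : n - F.card = k + 1 := by omega
    -- Every admissible row `i` keeps the rectangle Latin, so bounds uniform in `σ` multiply with
    -- the bounds on the number of `σ`, which come from a `(k + 1)`-regular system.
    have hstep : ∀ σ ∈ transversals (unusedSymbols F L₀), _ := fun σ hσ =>
      ih (insert i F) (Function.update L₀ i σ)
        (by rw [Finset.card_insert_of_notMem hi]; omega) (h.update hi hσ)
    rw [card_latinExtensions_eq_sum F L₀ hi, Nat.cast_sum, Finset.prod_range_succ,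
      Finset.prod_range_succ]
    constructor
    · have h1 := le_card_transversals (k := k + 1) (Nat.succ_pos k) (unusedSymbols F L₀)
        (fun j => hk ▸ card_unusedSymbols h j) (fun s => by
          rw [← hk, ← card_columns_unused h s])
      refine le_trans ?_ (Finset.card_nsmul_le_sum _ _ _ fun σ hσ => (hstep σ hσ).1)
      rw [nsmul_eq_mul, mul_comm]
      exact mul_le_mul_of_nonneg_right h1 (Finset.prod_nonneg fun j _ => by positivity)
    · have h1 := card_transversals_le (unusedSymbols F L₀)
      simp only [card_unusedSymbols h, hk, Finset.sum_const, Finset.card_univ, Fintype.card_fin,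
        nsmul_eq_mul] at h1
      refine (Finset.sum_le_card_nsmul _ _ _ fun σ hσ => (hstep σ hσ).2).trans ?_
      rw [nsmul_eq_mul, mul_comm]
      exact mul_le_mul_of_nonneg_left h1 (Finset.prod_nonneg fun j _ => (Real.exp_pos _).le)

/-- No Latin hypothesis is needed, as a rectangle with an extension is Latin. This matters because
sampled rows may clash in a column. -/
theorem card_latinExtensions_le {F : Finset (Fin n)} {L₀ : Fin n → Fin n → Fin n} {k : ℕ}
    (hk : F.card + k = n) : ((latinExtensions F L₀).card : ℝ) ≤
      ∏ j ∈ Finset.range k, Real.exp (n * logFactorialDiv (j + 1)) := by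
  rcases (latinExtensions F L₀).eq_empty_or_nonempty with h | h
  · rw [h]
    simpa using Finset.prod_nonneg fun j _ => (Real.exp_pos _).le
  · exact (card_latinExtensions_bounds k F L₀ hk (isLatinOn_of_nonempty h)).2

theorem coe_latinExtensions_empty (L₀ : Fin n → Fin n → Fin n) :
    (latinExtensions ∅ L₀ : Set (Fin n → Fin n → Fin n)) = latinSquares n := by
  ext L
  rw [Finset.mem_coe, mem_latinExtensions]
  exact ⟨fun h => h.1, fun h => ⟨h, by simp⟩⟩

theorem ncard_latinSquares (L₀ : Fin n → Fin n → Fin n) :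
    (latinSquares n).ncard = (latinExtensions ∅ L₀).card := by
  rw [← coe_latinExtensions_empty L₀]
  exact Set.ncard_coe_finset _

theorem ncard_latinSquares_bounds (n : ℕ) :
    ∏ j ∈ Finset.range n, (((j + 1 : ℕ) : ℝ) ^ n * (n.factorial / (n : ℝ) ^ n)) ≤
        (latinSquares n).ncard ∧
      ((latinSquares n).ncard : ℝ) ≤
        ∏ j ∈ Finset.range n, Real.exp (n * logFactorialDiv (j + 1)) := by
  rw [ncard_latinSquares fun _ j => j]
  exact card_latinExtensions_bounds n ∅ _ (by simp) ⟨by simp, by simp⟩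

theorem ncard_latinSquares_pos (n : ℕ) : 0 < (latinSquares n).ncard := by
  have h : (0 : ℝ) < (latinSquares n).ncard := by
    refine lt_of_lt_of_le (Finset.prod_pos fun j hj => ?_) (ncard_latinSquares_bounds n).1
    have : (0 : ℝ) < n := by
      have := Finset.mem_range.1 hj
      exact_mod_cast (by omega : 0 < n)
    positivity
  exact_mod_cast h

end Extensions

/-! ### The completion number: its bound and its sum over row tuples -/

section Completions

/-- The first `n - 3` rows, given the rows `R` after the first. -/
def initialRows (n : ℕ) (R : Fin (n - 4) → Fin n → Fin n) (r : Fin n) : Fin n → Fin n :=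
  -- The identity is the genuine row 0, but only a default for the last three rows.
  if h : (r : ℕ) - 1 < n - 4 ∧ 0 < (r : ℕ) then R ⟨r - 1, h.1⟩ else fun j => j

theorem numCompletions_eq {n : ℕ} (hn : 5 ≤ n) (R : Fin (n - 4) → Fin n → Fin n) :
    numCompletions n R =
      (latinExtensions (Finset.univ.filter fun r : Fin n => (r : ℕ) < n - 3)
        (initialRows n R)).card := by
  have key : ∀ L : Fin n → Fin n → Fin n,
      ((∀ r : Fin n, (r : ℕ) = 0 → ∀ j, L r j = j) ∧
        ∀ (i : Fin (n - 4)) (r : Fin n), (r : ℕ) = (i : ℕ) + 1 → ∀ j, L r j = R i j) ↔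
      ∀ r : Fin n, (r : ℕ) < n - 3 → L r = initialRows n R r := by
    refine fun L => ⟨fun h r hr => ?_, fun h => ⟨fun r hr j => ?_, fun i r hr j => ?_⟩⟩
    · funext j
      rcases Nat.eq_zero_or_pos (r : ℕ) with h0 | h0
      · rw [initialRows, dif_neg (by omega)]
        exact h.1 r h0 j
      · rw [initialRows, dif_pos ⟨by omega, h0⟩]
        exact h.2 ⟨r - 1, by omega⟩ r (by simp; omega) j
    · have := h r (by omega)
      rw [initialRows, dif_neg (by omega)] at this
      exact congrFun this j
    · have := h r (by omega)
      rw [initialRows, dif_pos ⟨by omega, by omega⟩] at this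
      rw [congrFun this j]
      congr
      omega
  rw [← Set.ncard_coe_finset]
  refine congrArg Set.ncard (Set.ext fun L => ⟨fun h => ?_, fun h => ?_⟩)
  · exact mem_latinExtensions.2 ⟨h.1, fun r hr => (key L).1 h.2 r (Finset.mem_filter.1 hr).2⟩
  · obtain ⟨h1, h2⟩ := mem_latinExtensions.1 (Finset.mem_coe.1 h)
    exact ⟨h1, (key L).2 fun r hr => h2 r (Finset.mem_filter.2 ⟨Finset.mem_univ r, hr⟩)⟩

/-- Brègman for three missing rows gives `3! ^ (n/3) * 2! ^ (n/2) * 1! ^ n`; the count is an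
integer, so the floor is harmless. -/
theorem numCompletions_le_acceptBound {n : ℕ} (hn : 5 ≤ n) (R : Fin (n - 4) → Fin n → Fin n) :
    numCompletions n R ≤ acceptBound n := by
  refine Nat.le_floor ?_
  rw [numCompletions_eq hn]
  have hcard : (Finset.univ.filter fun r : Fin n => (r : ℕ) < n - 3).card = n - 3 := by
    rw [Fin.card_filter_val_lt]
    omega
  refine (card_latinExtensions_le (k := 3) (by rw [hcard]; omega)).trans (le_of_eq ?_)
  simp only [Finset.prod_range_succ, Finset.prod_range_zero, one_mul, logFactorialDiv]
  rw [Real.rpow_def_of_pos (by norm_num), Real.rpow_def_of_pos (by norm_num), ← Real.exp_add,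
    ← Real.exp_add, ← Real.exp_add]
  congr 1
  norm_num [Nat.factorial]
  ring

theorem card_bijective (n : ℕ) (L₀ : Fin n → Fin n → Fin n) :
    (transversals (unusedSymbols ∅ L₀)).card = n.factorial := by
  have h : (Finset.univ : Finset (Equiv.Perm (Fin n))).card = n.factorial := by
    rw [Finset.card_univ, Fintype.card_perm, Fintype.card_fin]
  rw [← h]
  symm
  refine Finset.card_bij (fun e _ => ⇑e) ?_ ?_ ?_
  · intro e _
    exact mem_transversals.2 ⟨e.bijective, by simp [unusedSymbols]⟩
  · intro e _ e' _ h
    exact DFunLike.coe_injective h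
  · intro f hf
    exact ⟨Equiv.ofBijective f (mem_transversals.1 hf).1, Finset.mem_univ _, rfl⟩

theorem isLatinSquare_comp {n : ℕ} (e : Equiv.Perm (Fin n)) {L : Fin n → Fin n → Fin n}
    (h : IsLatinSquare L) : IsLatinSquare fun i j => e (L i j) :=
  ⟨fun i => e.bijective.comp (h.1 i), fun j => e.bijective.comp (h.2 j)⟩

/-- Relabelling the symbols by `σ` carries the squares with identity row `i` to those with row `i`
equal to `σ`. -/
theorem ncard_latinSquares_eq {n : ℕ} (i : Fin n) :
    (latinSquares n).ncard =
      n.factorial * (latinExtensions {i} fun _ j => j).card := by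
  rw [ncard_latinSquares fun _ j => j, card_latinExtensions_eq_sum ∅ _ (Finset.notMem_empty i),
    ← card_bijective n fun _ j => j, ← smul_eq_mul, ← Finset.sum_const]
  refine Finset.sum_congr rfl fun σ hσ => ?_
  set e := Equiv.ofBijective σ (mem_transversals.1 hσ).1 with he
  have heσ : ∀ j, e j = σ j := fun j => rfl
  symm
  refine Finset.card_bij (fun L _ i j => e (L i j)) ?_ ?_ ?_
  · intro L hL
    rw [mem_latinExtensions] at hL ⊢
    refine ⟨isLatinSquare_comp e hL.1, ?_⟩
    simp only [insert_empty_eq, Finset.mem_singleton, forall_eq, Function.update_self] at hL ⊢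
    rw [hL.2]
    rfl
  · intro L _ L' _ h
    funext i j
    exact e.injective (congrFun (congrFun h i) j)
  · intro L hL
    rw [mem_latinExtensions] at hL
    refine ⟨fun i j => e.symm (L i j), ?_, by simp⟩
    rw [mem_latinExtensions]
    refine ⟨isLatinSquare_comp e.symm hL.1, ?_⟩
    simp only [insert_empty_eq, Finset.mem_singleton, forall_eq, Function.update_self] at hL ⊢
    rw [hL.2]
    funext j
    rw [← heσ, Equiv.symm_apply_apply]

-- Below an identity first row, the column condition forces all later rows to be fixed-point-free,
-- so every normalized square is counted by exactly one tuple.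
open scoped Classical in
theorem sum_numCompletions {n : ℕ} (hn : 5 ≤ n) :
    n.factorial * ∑ R ∈ (rowTuples n).toFinset, numCompletions n R =
      (latinSquares n).ncard := by
  rw [ncard_latinSquares_eq (⟨0, by omega⟩ : Fin n)]
  congr 1
  symm
  have hmaps : ∀ L ∈ latinExtensions {(⟨0, by omega⟩ : Fin n)} (fun _ j => j),
      (fun (i : Fin (n - 4)) => L ⟨i + 1, by omega⟩) ∈ (rowTuples n).toFinset := by
    intro L hL
    rw [mem_latinExtensions] at hL
    rw [Set.mem_toFinset]
    refine fun i => ⟨hL.1.1 _, fun j hj => ?_⟩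
    have h0 := hL.2 ⟨0, by omega⟩ (by simp)
    have := (hL.1.2 j).1 (hj.trans (congrFun h0 j).symm)
    simp at this
  rw [Finset.card_eq_sum_card_fiberwise hmaps]
  refine Finset.sum_congr rfl fun R _ => ?_
  rw [numCompletions, ← Set.ncard_coe_finset]
  refine congrArg Set.ncard (Set.ext fun L => ?_)
  simp only [Finset.coe_filter, mem_latinExtensions, Set.mem_ofPred_eq, Finset.mem_singleton,
    forall_eq, and_assoc]
  refine and_congr Iff.rfl (and_congr ⟨fun h r hr j => ?_, fun h => ?_⟩
    ⟨fun h i r hr j => ?_, fun h => ?_⟩)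
  · rw [show r = ⟨0, by omega⟩ from Fin.ext hr, h]
  · exact funext fun j => h _ rfl j
  · rw [← h, show r = ⟨i + 1, by omega⟩ from Fin.ext hr]
  · exact funext fun i => funext fun j => h i _ rfl j

end Completions

/-! ### Derangements and the nearest integer to `n!/e` -/

section Derangements

theorem ncard_fixedPointFreeRows (n : ℕ) : (fixedPointFreeRows n).ncard = numDerangements n := by
  rw [← Fintype.card_fin n, ← card_derangements_eq_numDerangements, Fintype.card_fin,
    ← Nat.card_eq_fintype_card, Nat.card_coe_set_eq]
  symm
  refine Set.ncard_congr (fun (e : Equiv.Perm (Fin n)) _ => (e : Fin n → Fin n)) ?_ ?_ ?_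
  · exact fun e he => ⟨e.bijective, he⟩
  · exact fun e e' _ _ h => DFunLike.coe_injective h
  · exact fun f hf => ⟨Equiv.ofBijective f hf.1, hf.2, rfl⟩

/-- The derangement number is `n!` times the exponential series at `-1` truncated after `n + 1`
terms; the bound is `n!` times the tail estimate. -/
theorem abs_numDerangements_sub_le (n : ℕ) :
    |(n.factorial : ℝ) / Real.exp 1 - numDerangements n| ≤ (n + 2) / (n + 1) ^ 2 := by
  have h := Real.exp_bound (x := -1) (by simp) (n := n + 1) (Nat.succ_pos n)
  have hD : (numDerangements n : ℝ) =
      n.factorial * ∑ k ∈ Finset.range (n + 1), (-1 : ℝ) ^ k / k.factorial := by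
    have h1 := numDerangements_sum n
    have h2 : (numDerangements n : ℝ) =
        ∑ k ∈ Finset.range (n + 1), (-1 : ℝ) ^ k * (Nat.ascFactorial (k + 1) (n - k) : ℕ) := by
      exact_mod_cast congrArg (Int.cast : ℤ → ℝ) h1
    rw [h2, Finset.mul_sum]
    refine Finset.sum_congr rfl fun k hk => ?_
    have h3 := Nat.factorial_mul_ascFactorial k (n - k)
    rw [Nat.add_sub_cancel' (by have := Finset.mem_range.1 hk; omega)] at h3
    rw [← h3]
    have : (k.factorial : ℝ) ≠ 0 := by positivity
    push_cast
    field_simp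
  rw [hD, div_eq_mul_inv, ← Real.exp_neg, ← mul_sub, abs_mul, abs_of_nonneg (by positivity)]
  refine (mul_le_mul_of_nonneg_left h (by positivity)).trans (le_of_eq ?_)
  rw [Nat.factorial_succ]
  have : (n.factorial : ℝ) ≠ 0 := by positivity
  push_cast
  rw [abs_neg, abs_one, one_pow, one_mul]
  field_simp
  ring

theorem round_factorial_div_exp {n : ℕ} (hn : 5 ≤ n) :
    round ((n.factorial : ℝ) / Real.exp 1) = numDerangements n := by
  rw [round_eq, Int.floor_eq_iff]
  have h := abs_le.1 (abs_numDerangements_sub_le n)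
  have h2 : ((n : ℝ) + 2) / (n + 1) ^ 2 < 1 / 2 := by
    have : (5 : ℝ) ≤ n := by exact_mod_cast hn
    rw [div_lt_div_iff₀ (by positivity) (by norm_num)]
    nlinarith
  push_cast
  constructor <;> linarith [h.1, h.2]

theorem ncard_rowTuples (n : ℕ) : (rowTuples n).ncard = numDerangements n ^ (n - 4) := by
  classical
  have : rowTuples n = Set.pi Set.univ fun _ : Fin (n - 4) => fixedPointFreeRows n := by
    ext R
    simp [rowTuples]
  rw [this, ← ncard_fixedPointFreeRows, ← Nat.card_coe_set_eq, ← Nat.card_coe_set_eq,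
    Nat.card_congr (Equiv.Set.univPi _), Nat.card_pi]
  simp

end Derangements

/-! ### The geometric waiting time -/

section Sampling

theorem measurableSet_accepts (n : ℕ) : MeasurableSet {x : Pass n | Accepts n x} := by
  have : Measurable fun x : Pass n => (numCompletions n x.1 : ℝ) / (acceptBound n : ℝ) :=
    (measurable_of_finite fun R => (numCompletions n R : ℝ) / (acceptBound n : ℝ)).comp
      measurable_fst
  exact measurableSet_lt measurable_snd this

/-- The tail-sum formula `T = ∑ 1[T > t]`, valid also when `T = ∞`. -/
theorem numSamplings_eq_tsum (n : ℕ) (ω : ℕ → Pass n) :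
    numSamplings n ω = ∑' t : ℕ, Set.indicator
      {ω : ℕ → Pass n | ∀ s < t, ¬ Accepts n (ω s)} 1 ω := by
  classical
  by_cases h : ∃ t, Accepts n (ω t)
  · have hmin : ∀ t, (∀ s < t, ¬ Accepts n (ω s)) ↔ t ∈ Finset.range (Nat.find h + 1) := by
      intro t
      rw [Finset.mem_range, Nat.lt_succ_iff, Nat.le_find_iff]
    have hL : numSamplings n ω = (Nat.find h : ℝ≥0∞) + 1 := by
      refine le_antisymm (iInf₂_le (Nat.find h) (Nat.find_spec h)) (le_iInf₂ fun t ht => ?_)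
      gcongr
      exact Nat.find_min' h ht
    rw [hL, tsum_eq_sum (s := Finset.range (Nat.find h + 1))]
    · rw [Finset.sum_congr rfl (g := fun _ => (1 : ℝ≥0∞))]
      · simp
      · intro t ht
        rw [Set.indicator_of_mem]
        · rfl
        · exact (hmin t).2 ht
    · intro t ht
      rw [Set.indicator_of_notMem]
      exact fun h' => ht ((hmin t).1 h')
  · push Not at h
    have hL : numSamplings n ω = ∞ := by simp [numSamplings, h]
    have : ∀ t : ℕ, Set.indicator {ω : ℕ → Pass n | ∀ s < t, ¬ Accepts n (ω s)}
        (1 : (ℕ → Pass n) → ℝ≥0∞) ω = 1 := fun t => by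
      rw [Set.indicator_of_mem]
      · rfl
      · exact fun s _ => h s
    simp only [this, hL]
    exact (ENNReal.tsum_const_eq_top_of_ne_zero one_ne_zero).symm

/-- By independence the first `t` passes all fail with probability `(1 - p) ^ t`; the geometric
series in `ℝ≥0∞` covers `p = 0` as well. -/
theorem expectedSamplings_eq_inv (n : ℕ) :
    expectedSamplings n = (passLaw n {x | Accepts n x})⁻¹ := by
  have hset : ∀ t : ℕ, {ω : ℕ → Pass n | ∀ s < t, ¬ Accepts n (ω s)} =
      Set.pi (Finset.range t : Set ℕ) fun _ => {x : Pass n | Accepts n x}ᶜ := by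
    intro t
    ext ω
    simp [Set.mem_pi]
  have hmeas : ∀ t : ℕ, MeasurableSet {ω : ℕ → Pass n | ∀ s < t, ¬ Accepts n (ω s)} := fun t => by
    rw [hset]
    exact MeasurableSet.pi (Finset.countable_toSet _) fun _ _ => (measurableSet_accepts n).compl
  have hprob : ∀ t : ℕ, runLaw n {ω : ℕ → Pass n | ∀ s < t, ¬ Accepts n (ω s)} =
      (1 - passLaw n {x | Accepts n x}) ^ t := fun t => by
    rw [hset, runLaw, Measure.infinitePi_pi _ fun _ _ => (measurableSet_accepts n).compl,
      Finset.prod_const, Finset.card_range, prob_compl_eq_one_sub (measurableSet_accepts n)]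
  unfold expectedSamplings
  simp only [numSamplings_eq_tsum]
  rw [lintegral_tsum fun t => (measurable_one.indicator (hmeas t)).aemeasurable]
  simp only [lintegral_indicator_one (hmeas _), hprob]
  rw [ENNReal.tsum_geometric, ENNReal.sub_sub_cancel ENNReal.one_ne_top prob_le_one]

theorem acceptBound_pos {n : ℕ} : 0 < acceptBound n := by
  refine Nat.floor_pos.2 ?_
  exact one_le_mul_of_one_le_of_one_le (Real.one_le_rpow (by norm_num) (by positivity))
    (Real.one_le_rpow (by norm_num) (by positivity))

theorem passLaw_accepts {n : ℕ} (hn : 5 ≤ n) :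
    passLaw n {x | Accepts n x} = ENNReal.ofReal (E n)⁻¹ := by
  classical
  have hB : (0 : ℝ) < acceptBound n := by exact_mod_cast acceptBound_pos
  have hrow : ∀ R, (volume.restrict (Set.Ioo (0 : ℝ) 1)) {u : ℝ | Accepts n (R, u)} =
      ENNReal.ofReal ((numCompletions n R : ℝ) / acceptBound n) := by
    intro R
    have h1 : (numCompletions n R : ℝ) / acceptBound n ≤ 1 := by
      rw [div_le_one hB]
      exact_mod_cast numCompletions_le_acceptBound hn R
    have hset : {u : ℝ | Accepts n (R, u)} =
        Set.Iio ((numCompletions n R : ℝ) / acceptBound n) := rfl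
    rw [hset, Measure.restrict_apply measurableSet_Iio, Set.inter_comm, Set.Ioo_inter_Iio,
      min_eq_right h1, Real.volume_Ioo, sub_zero]
  have hne : (rowTuples n).toFinset.Nonempty := by
    simpa using rowTuples_nonempty n
  rw [passLaw, Measure.prod_apply (measurableSet_accepts n)]
  have : ∀ R, (volume.restrict (Set.Ioo (0 : ℝ) 1)) (Prod.mk R ⁻¹' {x | Accepts n x}) =
      ENNReal.ofReal ((numCompletions n R : ℝ) / acceptBound n) := hrow
  simp only [this]
  rw [ProbabilityTheory.uniformOn, ProbabilityTheory.cond, lintegral_smul_measure,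
    ← Set.coe_toFinset (rowTuples n), lintegral_finset, Measure.count_apply_finset]
  simp only [Measure.count_singleton, mul_one]
  rw [← ENNReal.ofReal_sum_of_nonneg fun R _ => by positivity, smul_eq_mul,
    ← ENNReal.ofReal_natCast, ← ENNReal.ofReal_inv_of_pos (by exact_mod_cast hne.card_pos),
    ← ENNReal.ofReal_mul (by positivity), ← Finset.sum_div]
  congr 1
  have hcard : (rowTuples n).toFinset.card = numDerangements n ^ (n - 4) := by
    rw [← ncard_rowTuples, Set.ncard_eq_toFinset_card']
  have hsum : (n.factorial : ℝ) * ∑ R ∈ (rowTuples n).toFinset, (numCompletions n R : ℝ) =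
      (latinSquares n).ncard := by
    exact_mod_cast sum_numCompletions hn
  rw [E, round_factorial_div_exp hn, hcard, ← hsum]
  have : (n.factorial : ℝ) ≠ 0 := by positivity
  push_cast
  rw [mul_div_cancel_left₀ _ this, inv_div, div_eq_mul_inv, div_eq_mul_inv, mul_inv]
  ring

theorem E_pos {n : ℕ} (hn : 5 ≤ n) : 0 < E n := by
  have hB : (0 : ℝ) < acceptBound n := by exact_mod_cast acceptBound_pos
  have hL : (0 : ℝ) < (latinSquares n).ncard := by exact_mod_cast ncard_latinSquares_pos n
  have hD : (0 : ℝ) < (numDerangements n : ℝ) ^ (n - 4) := by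
    have h : (rowTuples n).ncard ≠ 0 :=
      (Set.ncard_pos (Set.toFinite _)).2 (rowTuples_nonempty n) |>.ne'
    rw [ncard_rowTuples] at h
    exact_mod_cast Nat.pos_of_ne_zero h
  rw [E, round_factorial_div_exp hn]
  push_cast
  positivity

theorem expectedSamplings_eq {n : ℕ} (hn : 5 ≤ n) :
    expectedSamplings n = ENNReal.ofReal (E n) := by
  rw [expectedSamplings_eq_inv, passLaw_accepts hn, ENNReal.ofReal_inv_of_pos (E_pos hn), inv_inv]

end Sampling

/-! ### Asymptotics of the logarithms -/

section Asymptotics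

theorem tendsto_log_div_self : Tendsto (fun n : ℕ => Real.log n / n) atTop (𝓝 0) := by
  have h := Real.isLittleO_log_id_atTop.tendsto_div_nhds_zero
  exact h.comp tendsto_natCast_atTop_atTop

theorem tendsto_logFactorialDiv_sub_log :
    Tendsto (fun n : ℕ => logFactorialDiv n - Real.log n) atTop (𝓝 (-1)) := by
  have h1 : Tendsto (fun n : ℕ => Real.log (Stirling.stirlingSeq n) / n) atTop (𝓝 0) :=
    (Stirling.tendsto_stirlingSeq_sqrt_pi.log (by positivity)).div_atTop
      tendsto_natCast_atTop_atTop
  have h2 : Tendsto (fun n : ℕ => Real.log 2 / n) atTop (𝓝 0) :=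
    tendsto_const_nhds.div_atTop tendsto_natCast_atTop_atTop
  have h3 := (h1.add ((h2.add tendsto_log_div_self).const_mul (1 / 2))).sub_const 1
  norm_num at h3
  refine h3.congr' ?_
  filter_upwards [eventually_gt_atTop 0] with n hn
  have hn' : (0 : ℝ) < n := by exact_mod_cast hn
  rw [Stirling.log_stirlingSeq_formula, Real.log_mul (by norm_num) hn'.ne',
    Real.log_div hn'.ne' (Real.exp_pos 1).ne', Real.log_exp, logFactorialDiv]
  field_simp
  ring

/-- Write `φ = logFactorialDiv`. The lower bound becomes `2 (φ n - log n)`. Since `∑ log j = log n!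
= n φ n`, the upper one is the Cesàro mean of `φ j - log j` plus `φ n - log n`. Both tend to `-2`.
-/
theorem tendsto_log_ncard_latinSquares :
    Tendsto (fun n : ℕ => Real.log (latinSquares n).ncard / (n : ℝ) ^ 2 - Real.log n)
      atTop (𝓝 (-2)) := by
  have hf := tendsto_logFactorialDiv_sub_log
  have hces := ((tendsto_add_atTop_iff_nat 1).2 hf).cesaro
  have hlow := hf.const_mul 2
  have hupp := hces.add hf
  norm_num at hlow hupp
  refine tendsto_of_tendsto_of_tendsto_of_le_of_le' hlow hupp ?_ ?_
  · filter_upwards [eventually_gt_atTop 0] with n hn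
    have hn' : (0 : ℝ) < n := by exact_mod_cast hn
    have h := Real.log_le_log (Finset.prod_pos fun j _ => by positivity)
      (ncard_latinSquares_bounds n).1
    have e : Real.log (∏ j ∈ Finset.range n,
        (((j + 1 : ℕ) : ℝ) ^ n * (n.factorial / (n : ℝ) ^ n))) =
        2 * (n * Real.log n.factorial) - (n : ℝ) ^ 2 * Real.log n := by
      rw [Finset.prod_mul_distrib, Finset.prod_pow, Finset.prod_const, Finset.card_range,
        ← Nat.cast_prod, Finset.prod_range_add_one_eq_factorial,
        Real.log_mul (by positivity) (by positivity), Real.log_pow, Real.log_pow,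
        Real.log_div (by positivity) (by positivity), Real.log_pow]
      ring
    rw [e] at h
    rw [le_sub_iff_add_le, le_div_iff₀ (by positivity)]
    refine le_trans (le_of_eq ?_) h
    rw [logFactorialDiv]
    field_simp
    ring
  · filter_upwards [eventually_gt_atTop 0] with n hn
    have hn' : (0 : ℝ) < n := by exact_mod_cast hn
    have hL : (0 : ℝ) < (latinSquares n).ncard := by exact_mod_cast ncard_latinSquares_pos n
    have h := Real.log_le_log hL (ncard_latinSquares_bounds n).2
    rw [← Real.exp_sum, Real.log_exp, ← Finset.mul_sum] at h
    have e : ∑ j ∈ Finset.range n, Real.log ((j : ℝ) + 1) = Real.log n.factorial := by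
      rw [← Finset.prod_range_add_one_eq_factorial, Nat.cast_prod,
        Real.log_prod fun j _ => by positivity]
      simp
    rw [sub_le_iff_le_add, div_le_iff₀ (by positivity)]
    refine h.trans (le_of_eq ?_)
    simp only [e]
    rw [logFactorialDiv]
    field_simp
    ring

theorem tendsto_log_acceptBound :
    Tendsto (fun n : ℕ => Real.log (acceptBound n) / (n : ℝ) ^ 2) atTop (𝓝 0) := by
  have hupp : Tendsto (fun n : ℕ => (Real.log 6 / 3 + Real.log 2 / 2) / (n : ℝ)) atTop (𝓝 0) :=
    tendsto_const_nhds.div_atTop tendsto_natCast_atTop_atTop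
  refine tendsto_of_tendsto_of_tendsto_of_le_of_le' tendsto_const_nhds hupp ?_ ?_
  · exact Eventually.of_forall fun n => by positivity
  · filter_upwards [eventually_gt_atTop 0] with n hn
    have hn' : (0 : ℝ) < n := by exact_mod_cast hn
    have hB : (0 : ℝ) < acceptBound n := by exact_mod_cast acceptBound_pos
    have h := Real.log_le_log hB (Nat.floor_le (show
      (0 : ℝ) ≤ (6 : ℝ) ^ ((n : ℝ) / 3) * (2 : ℝ) ^ ((n : ℝ) / 2) by positivity))
    rw [Real.log_mul (by positivity) (by positivity), Real.log_rpow (by norm_num),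
      Real.log_rpow (by norm_num)] at h
    rw [div_le_iff₀ (by positivity)]
    refine h.trans (le_of_eq ?_)
    field_simp

theorem tendsto_log_numDerangements :
    Tendsto (fun n : ℕ => Real.log (numDerangements n) / n - Real.log n) atTop (𝓝 (-1)) := by
  have h1 : Tendsto (fun n : ℕ => Real.log ((numDerangements n : ℝ) / n.factorial) / n)
      atTop (𝓝 0) :=
    (numDerangements_tendsto_inv_e.log (Real.exp_pos _).ne').div_atTop
      tendsto_natCast_atTop_atTop
  have h2 := h1.add tendsto_logFactorialDiv_sub_log
  rw [zero_add] at h2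
  refine h2.congr' ?_
  have h3 := numDerangements_tendsto_inv_e.eventually_const_lt (Real.exp_pos _)
  filter_upwards [eventually_gt_atTop 0, h3] with n hn hn3
  have hf : (0 : ℝ) < n.factorial := by positivity
  have hD : (0 : ℝ) < numDerangements n := by
    exact (div_pos_iff_of_pos_right hf).1 hn3
  rw [Real.log_div hD.ne' hf.ne', logFactorialDiv]
  ring

theorem tendsto_E_rpow :
    Tendsto (fun n : ℕ => E n ^ (1 / (n : ℝ) ^ 2)) atTop (𝓝 (Real.exp 1)) := by
  have hone : Tendsto (fun n : ℕ => 1 - 4 / (n : ℝ)) atTop (𝓝 (1 - 0)) :=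
    tendsto_const_nhds.sub (tendsto_const_nhds.div_atTop tendsto_natCast_atTop_atTop)
  have hinv : Tendsto (fun n : ℕ => 1 / (n : ℝ)) atTop (𝓝 0) :=
    tendsto_const_nhds.div_atTop tendsto_natCast_atTop_atTop
  -- The summands of `log (E n) / n²`, each centred by its multiple of `log n`; `hone` and the term
  -- `4 * (log n / n)` account for the exponent `n - 4`, and the remaining `log n` cancels against
  -- `|LS_n|`.
  have hlim := ((((tendsto_log_acceptBound.add (hone.mul tendsto_log_numDerangements)).sub
    (tendsto_log_div_self.const_mul 4)).add (tendsto_logFactorialDiv_sub_log.mul hinv)).add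
    tendsto_log_div_self).sub tendsto_log_ncard_latinSquares
  norm_num at hlim
  refine (Real.continuous_exp.continuousAt.tendsto.comp hlim).congr' ?_
  filter_upwards [eventually_ge_atTop 5] with n hn
  have hn' : (0 : ℝ) < n := by exact_mod_cast (by omega : 0 < n)
  have hE := E_pos hn
  rw [Real.rpow_def_of_pos hE, Function.comp_apply]
  congr 1
  have hB : (0 : ℝ) < acceptBound n := by exact_mod_cast acceptBound_pos
  have hL : (0 : ℝ) < (latinSquares n).ncard := by exact_mod_cast ncard_latinSquares_pos n
  have hf : (0 : ℝ) < n.factorial := by positivity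
  have hD : (numDerangements n : ℝ) ^ (n - 4) ≠ 0 := by
    intro h
    rw [E, round_factorial_div_exp hn, Int.cast_natCast, h] at hE
    simp at hE
  rw [E, round_factorial_div_exp hn, Int.cast_natCast,
    Real.log_div (mul_ne_zero hB.ne' hD) (div_pos hL hf).ne', Real.log_mul hB.ne' hD,
    Real.log_div hL.ne' hf.ne', Real.log_pow, Nat.cast_sub (by omega), logFactorialDiv]
  push_cast
  field_simp
  ring

end Asymptotics

end LatinSampling

theorem mainTheorem5 :
    (∀ n : ℕ, 5 ≤ n →
      LatinSampling.expectedSamplings n = ENNReal.ofReal (LatinSampling.E n)) ∧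
    Tendsto (fun n : ℕ => LatinSampling.E n ^ (1 / (n : ℝ) ^ 2)) atTop (𝓝 (Real.exp 1)) :=
  ⟨fun _ hn => LatinSampling.expectedSamplings_eq hn, LatinSampling.tendsto_E_rpow⟩
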